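/- **Theorem (Logistic regression with dependent samples).** Let $d,n\ge 1$. Let $X\in\mathbb R^{n\times d}$ have rows $x_1^\top,\dots,x_n^\top$, let $A\in\mathbb R^{n\times n}$, and for $(\theta,\beta)\in\mathbb R^d\times\mathbb R$ consider the model on $\{-1,1\}^n$ $$\Pr_{\theta,\beta}\{y=\sigma\}=\frac{\exp\big(\sum_{i=1}^n(\theta^\top x_i)\sigma_i+\beta\,\sigma^\top A\sigma\big)}{\sum_{\tilde\sigma\in\{-1,1\}^n}\exp\big(\sum_{i=1}^n(\theta^\top x_i)\tilde\sigma_i+\beta\,\tilde\sigma^\top A\tilde\sigma\big)} .$$ For a single sample $y$, let $f_i(\theta,\beta,y)=\Pr_{\theta,\beta}\{y_i\mid y_{-i}\}$ be the conditional likelihood of $y_i$ given the other responses, let $PL(\theta,\beta)=\prod_{i=1}^n f_i(\theta,\beta,y)$ and $LPL=\frac1n\log PL$. A maximum pseudo-likelihood estimate (MPLE) is a maximizer $(\hat\theta,\hat\beta)$ of $PL$ over $\mathbb R^{d}\times\mathbb R$. Fix $d\ge1$ and constants $\Theta,B,M,c,q_1,q_2,\delta>0$. Call $(X,A)$ *admissible*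 if $A$ is symmetric with zero diagonal, $\|A\|_\infty=\max_j\sum_i|A_{ij}|\le 1$, $\|A\|_F^2\ge cn$, $x_i\in[-M,M]^d$ for all $i$, and all eigenvalues of $Q=\frac1nX^\top X$ lie in $[q_1,q_2]$. Then there is a constant $C>0$, depending only on $d,\Theta,B,M,c,q_1,q_2,\delta$, such that the following hold. 1. There is $n_0$, depending only on the same constants, such that for all $n\ge n_0$, all admissible $(X,A)$ and all $(\theta_0,\beta_0)\in(-\Theta,\Theta)^d\times(-B,B)$, with probability at least $1-\delta$ over $y\sim\Pr_{\theta_0,\beta_0}$, the MPLE $(\hat\theta,\hat\beta)$ exists, is unique, and $$\|(\hat\theta,\hat\beta)-(\theta_0,\beta_0)\|_2\le \frac{C}{\sqrt n}.$$ 2. Consider projected gradient descent for $-LPL$ on $[-\Theta,\Theta]^d\times[-B,B]$, started at $0$, with step size $\eta=\frac1{dM^2+4}$. Each iteration evaluates the gradient at the current iterate, takes a step of size $\eta$ along the negative gradient and projects coordinatewise onto the box; the algorithm stops, and returns the new iterate, after the first iteration whose evaluated gradient has Euclidean norm at most $1/\sqrt n$. For every $(\theta_0,\beta_0)\in(-\Theta,\Theta)^d\times(-B,B)$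 there is $n_0$ such that for all $n\ge n_0$ and all admissible $(X,A)$, with probability at least $1-\delta$ over $y\sim\Pr_{\theta_0,\beta_0}$, the MPLE $(\hat\theta,\hat\beta)$ exists and is unique, and the algorithm halts after at most $C\ln n$ iterations and returns $(\tilde\theta,\tilde\beta)$ with $$\|(\hat\theta,\hat\beta)-(\tilde\theta,\tilde\beta)\|_2\le\frac{C}{\sqrt n}.$$ Moreover, each iteration takes $O(dn)$ time: there are a single program for a unit-cost real random access machine (arithmetic operations, $\sqrt{\cdot}$, $\tanh$, comparisons, memory accesses and loop steps cost one each) and an absolute constant $K$ such that, for all $n,d\ge1$, all $X$, all symmetric $A$ with zero diagonal, all $y\in\{-1,1\}^n$, all $\Theta,B,\eta\in\mathbb R$ and every current iterate, the program, given $n$, $d$, $y$, $X$, the magnetizations $m_i(y)=\sum_jA_{ij}y_j$, the numbers $\Theta,B,\eta$ and the current iterate, computes the next iterate $(\theta,\beta)$, where projection means replacing each $\theta_k$ by $\max(-\Theta,\min(\Theta,\theta_k))$ and $\beta$ by $\max(-B,\min(B,\beta))$, together with the norm of the gradient at the current iterate, in at most $K\,d\,n$ steps. -/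

import Mathlib

open scoped Matrix

noncomputable section

/-! ## The Ising model with covariates -/

namespace IsingRegression

/-- Spin configurations `{-1, +1}ⁿ`; the two elements of `ℤˣ` are `1` and `-1`. -/
abbrev Config (n : ℕ) : Type := Fin n → ℤˣ

/-- A configuration as a real vector with entries `±1`. -/
def spin {n : ℕ} (y : Config n) : Fin n → ℝ := fun i => ((y i : ℤ) : ℝ)

/-- Parameters `(θ, β) ∈ ℝᵈ × ℝ`, with the Euclidean norm of `ℝᵈ⁺¹`. -/
abbrev Param (d : ℕ) : Type := WithLp 2 (EuclideanSpace ℝ (Fin d) × ℝ)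

/-- The exponent `∑ᵢ (θᵀ xᵢ) σᵢ + β σᵀ A σ`; the `i`-th row of `X` is `xᵢ`. -/
def exponent {n d : ℕ} (X : Matrix (Fin n) (Fin d) ℝ) (A : Matrix (Fin n) (Fin n) ℝ)
    (p : Param d) (y : Config n) : ℝ :=
  ∑ i, (∑ k, p.fst k * X i k) * spin y i + p.snd * (spin y ⬝ᵥ (A *ᵥ spin y))

/-- The point probabilities `Pr_{θ,β}(y = σ)` of the model. -/
def law {n d : ℕ} (X : Matrix (Fin n) (Fin d) ℝ) (A : Matrix (Fin n) (Fin n) ℝ)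
    (p : Param d) (y : Config n) : ℝ :=
  Real.exp (exponent X A p y) / ∑ σ : Config n, Real.exp (exponent X A p σ)

/-- The probability `Pr_{θ,β}(y ∈ E)` of an event. -/
def prob {n d : ℕ} (X : Matrix (Fin n) (Fin d) ℝ) (A : Matrix (Fin n) (Fin n) ℝ)
    (p : Param d) (E : Set (Config n)) : ℝ :=
  ∑ y : Config n, E.indicator (law X A p) y

/-- The conditional likelihood `Pr_{θ,β}(yᵢ | y₋ᵢ)` of the `i`-th response given all others. -/
def condLik {n d : ℕ} (X : Matrix (Fin n) (Fin d) ℝ) (A : Matrix (Fin n) (Fin n) ℝ)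
    (p : Param d) (y : Config n) (i : Fin n) : ℝ :=
  law X A p y / ∑ s : ℤˣ, law X A p (Function.update y i s)

/-- The pseudo-likelihood of the sample `y`. -/
def PL {n d : ℕ} (X : Matrix (Fin n) (Fin d) ℝ) (A : Matrix (Fin n) (Fin n) ℝ)
    (y : Config n) (p : Param d) : ℝ :=
  ∏ i, condLik X A p y i

/-- The normalized log-pseudo-likelihood. -/
def LPL {n d : ℕ} (X : Matrix (Fin n) (Fin d) ℝ) (A : Matrix (Fin n) (Fin n) ℝ)
    (y : Config n) (p : Param d) : ℝ :=
  (1 / (n : ℝ)) * Real.log (PL X A y p)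

/-- `p` maximizes the pseudo-likelihood over the whole of `ℝᵈ⁺¹`. -/
def IsMPLE {n d : ℕ} (X : Matrix (Fin n) (Fin d) ℝ) (A : Matrix (Fin n) (Fin n) ℝ)
    (y : Config n) (p : Param d) : Prop :=
  ∀ q : Param d, PL X A y q ≤ PL X A y p

/-- `(θ, β)` lies in the open box `(-Θ, Θ)ᵈ × (-B, B)`. -/
def InOpenBox {d : ℕ} (Θ B : ℝ) (p : Param d) : Prop :=
  (∀ k, p.fst k ∈ Set.Ioo (-Θ) Θ) ∧ p.snd ∈ Set.Ioo (-B) B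

/-- The conditions on the interaction matrix and on the features. -/
structure Admissible {n d : ℕ} (M c q₁ q₂ : ℝ)
    (X : Matrix (Fin n) (Fin d) ℝ) (A : Matrix (Fin n) (Fin n) ℝ) : Prop where
  symm : A.IsSymm
  diag_zero : ∀ i, A i i = 0
  /-- `‖A‖_∞ ≤ 1` -/
  norm_le : ∀ j, ∑ i, |A i j| ≤ 1
  /-- `‖A‖_F² ≥ c n` -/
  frobenius_ge : c * n ≤ ∑ i, ∑ j, A i j ^ 2
  /-- the feature vectors lie in `[-M, M]ᵈ` -/
  feature_le : ∀ i k, |X i k| ≤ M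
  /-- all eigenvalues of `Q = n⁻¹ Xᵀ X` lie in `[q₁, q₂]` -/
  spectrum_subset : spectrum ℝ ((1 / (n : ℝ)) • (Xᵀ * X)) ⊆ Set.Icc q₁ q₂

/-! ## Projected gradient descent on the negative log-pseudo-likelihood -/

/-- The gradient of the negative normalized log-pseudo-likelihood. -/
def grad {n d : ℕ} (X : Matrix (Fin n) (Fin d) ℝ) (A : Matrix (Fin n) (Fin n) ℝ)
    (y : Config n) (p : Param d) : Param d :=
  gradient (fun q => - LPL X A y q) p

/-- The Euclidean projection onto `[-Θ, Θ]ᵈ × [-B, B]`. -/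
def projBox {d : ℕ} (Θ B : ℝ) (p : Param d) : Param d :=
  WithLp.toLp 2 (WithLp.toLp 2 fun k => max (-Θ) (min Θ (p.fst k)), max (-B) (min B p.snd))

/-- One iteration with step size `η`. -/
def pgdStep {n d : ℕ} (X : Matrix (Fin n) (Fin d) ℝ) (A : Matrix (Fin n) (Fin n) ℝ)
    (y : Config n) (Θ B η : ℝ) (p : Param d) : Param d :=
  projBox Θ B (p - η • grad X A y p)

/-- The iterates, started at `(θ, β) = 0`. -/
def pgdIter {n d : ℕ} (X : Matrix (Fin n) (Fin d) ℝ) (A : Matrix (Fin n) (Fin n) ℝ)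
    (y : Config n) (Θ B η : ℝ) : ℕ → Param d
  | 0 => 0
  | t + 1 => pgdStep X A y Θ B η (pgdIter X A y Θ B η t)

/-- The algorithm halts after exactly `T` iterations and returns `p`. An iteration evaluates the
gradient at the current iterate and moves to the next iterate; the loop is left after the first
iteration whose gradient has norm at most `1 / √n`. -/
def PGDReturns {n d : ℕ} (X : Matrix (Fin n) (Fin d) ℝ) (A : Matrix (Fin n) (Fin n) ℝ)
    (y : Config n) (Θ B η : ℝ) (T : ℕ) (p : Param d) : Prop :=
  ∃ t : ℕ, T = t + 1 ∧
    (∀ s < t, 1 / √(n : ℝ) < ‖grad X A y (pgdIter X A y Θ B η s)‖) ∧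
    ‖grad X A y (pgdIter X A y Θ B η t)‖ ≤ 1 / √(n : ℝ) ∧
    p = pgdIter X A y Θ B η T

end IsingRegression

/-! ## A unit-cost real random access machine

Programs of a small structured language over a memory of real cells, grouped in two-dimensional
arrays, and natural-number registers that hold sizes and loop counters. Every arithmetic
operation, evaluation of `√` or `tanh`, memory access, comparison and loop step costs one. -/

namespace RealRAM

/-- Array indices and loop bounds: a literal or the content of a register. -/
inductive Idx : Type where
  | lit (c : ℕ) : Idx
  | var (v : ℕ) : Idx

/-- Machine states: `mem a i j` is the cell `(i, j)` of the array `a`. -/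
structure State : Type where
  reg : ℕ → ℕ
  mem : ℕ → ℕ → ℕ → ℝ

/-- The value of an index. -/
def Idx.eval (s : State) : Idx → ℕ
  | .lit c => c
  | .var v => s.reg v

/-- Real-valued expressions. -/
inductive Expr : Type where
  | const (q : ℚ) : Expr
  | ofIdx (i : Idx) : Expr
  | read (a : ℕ) (i j : Idx) : Expr
  | add (e₁ e₂ : Expr) : Expr
  | sub (e₁ e₂ : Expr) : Expr
  | mul (e₁ e₂ : Expr) : Expr
  | div (e₁ e₂ : Expr) : Expr
  | sqrt (e : Expr) : Expr
  | tanh (e : Expr) : Expr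

/-- The value of an expression. -/
def Expr.eval (s : State) : Expr → ℝ
  | .const q => (q : ℝ)
  | .ofIdx i => (i.eval s : ℝ)
  | .read a i j => s.mem a (i.eval s) (j.eval s)
  | .add e₁ e₂ => e₁.eval s + e₂.eval s
  | .sub e₁ e₂ => e₁.eval s - e₂.eval s
  | .mul e₁ e₂ => e₁.eval s * e₂.eval s
  | .div e₁ e₂ => e₁.eval s / e₂.eval s
  | .sqrt e => √(e.eval s)
  | .tanh e => Real.tanh (e.eval s)

/-- The cost of evaluating an expression: its number of nodes. -/
def Expr.cost : Expr → ℕ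
  | .const _ => 1
  | .ofIdx _ => 1
  | .read _ _ _ => 1
  | .add e₁ e₂ => e₁.cost + e₂.cost + 1
  | .sub e₁ e₂ => e₁.cost + e₂.cost + 1
  | .mul e₁ e₂ => e₁.cost + e₂.cost + 1
  | .div e₁ e₂ => e₁.cost + e₂.cost + 1
  | .sqrt e => e.cost + 1
  | .tanh e => e.cost + 1

/-- Programs. `loop v N c` runs `c` with register `v` set to `0, 1, …, N - 1` in turn. -/
inductive Cmd : Type where
  | skip : Cmd
  | write (a : ℕ) (i j : Idx) (e : Expr) : Cmd
  | seq (c₁ c₂ : Cmd) : Cmd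
  | ifLe (e₁ e₂ : Expr) (c₁ c₂ : Cmd) : Cmd
  | loop (v : ℕ) (N : Idx) (c : Cmd) : Cmd

/-- Set a register. -/
def State.setReg (s : State) (v k : ℕ) : State :=
  { s with reg := Function.update s.reg v k }

/-- Set a memory cell. -/
def State.setMem (s : State) (a i j : ℕ) (x : ℝ) : State :=
  { s with mem := fun a' i' j' => if a' = a ∧ i' = i ∧ j' = j then x else s.mem a' i' j' }

/-- Run `f` with register `v` equal to `0, …, N - 1`, and add up the costs,
with one unit for every round and one for leaving the loop. -/
def runLoop (f : State → State × ℕ) (v : ℕ) (s : State) : ℕ → State × ℕ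
  | 0 => (s, 1)
  | k + 1 =>
    let r := runLoop f v s k
    let r' := f (r.1.setReg v k)
    (r'.1, r.2 + r'.2 + 1)

/-- The final state of a program and the number of steps it takes. -/
def Cmd.exec : Cmd → State → State × ℕ
  | .skip, s => (s, 1)
  | .write a i j e, s => (s.setMem a (i.eval s) (j.eval s) (e.eval s), e.cost + 1)
  | .seq c₁ c₂, s =>
    let r₁ := c₁.exec s
    let r₂ := c₂.exec r₁.1
    (r₂.1, r₁.2 + r₂.2)
  | .ifLe e₁ e₂ c₁ c₂, s =>
    open Classical in
    let r := if e₁.eval s ≤ e₂.eval s then c₁.exec s else c₂.exec s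
    (r.1, e₁.cost + e₂.cost + 1 + r.2)
  | .loop v N c, s => runLoop c.exec v s (N.eval s)

end RealRAM

namespace IsingRegression

/-- The memory layout of the algorithm: the sizes `n`, `d` in the registers `0`, `1`, the sample
`y`, the magnetizations `mᵢ = ∑ⱼ Aᵢⱼ yⱼ`, the features and the current `θ` in the arrays
`0`, `1`, `2`, `3`, and `β`, `Θ`, `B`, `η` in the cells `0`, `1`, `2`, `3` of the array `4`.
Nothing is required of the other registers and cells. -/
structure Encodes {n d : ℕ} (X : Matrix (Fin n) (Fin d) ℝ) (A : Matrix (Fin n) (Fin n) ℝ)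
    (y : Config n) (Θ B η : ℝ) (p : Param d) (s : RealRAM.State) : Prop where
  reg_n : s.reg 0 = n
  reg_d : s.reg 1 = d
  mem_y : ∀ i : Fin n, s.mem 0 i 0 = spin y i
  mem_m : ∀ i : Fin n, s.mem 1 i 0 = (A *ᵥ spin y) i
  mem_X : ∀ (i : Fin n) (k : Fin d), s.mem 2 i k = X i k
  mem_θ : ∀ k : Fin d, s.mem 3 k 0 = p.fst k
  mem_β : s.mem 4 0 0 = p.snd
  mem_Θ : s.mem 4 1 0 = Θ
  mem_B : s.mem 4 2 0 = B
  mem_η : s.mem 4 3 0 = η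

/-- The program `P` performs one iteration of projected gradient descent in at most `K d n` steps,
for all sizes, all data, all projection boxes and all step sizes: it replaces the current iterate
by the next one and leaves the norm of the gradient at the current iterate, on which the loop test
depends, in the cell `4` of the array `4`. -/
def PerformsIteration (P : RealRAM.Cmd) (K : ℕ) : Prop :=
  ∀ (n d : ℕ), 0 < n → 0 < d →
    ∀ (X : Matrix (Fin n) (Fin d) ℝ) (A : Matrix (Fin n) (Fin n) ℝ),
      A.IsSymm → (∀ i, A i i = 0) →
    ∀ (y : Config n) (Θ B η : ℝ) (p : Param d) (s : RealRAM.State),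
      Encodes X A y Θ B η p s →
        Encodes X A y Θ B η (pgdStep X A y Θ B η p) (P.exec s).1 ∧
        (P.exec s).1.mem 4 4 0 = ‖grad X A y p‖ ∧
        (P.exec s).2 ≤ K * (d * n)

end IsingRegression

end

/-!
# Logistic regression with dependent samples

With the local fields `aᵢ(p) = ⟪zᵢ, p⟫`, `zᵢ = (xᵢ, 2 mᵢ)`, the conditional likelihood of `yᵢ` is
`exp (yᵢ aᵢ) / (2 cosh aᵢ)`. The negative log-pseudo-likelihood is therefore the convex function
`(1 / n) ∑ᵢ (log (2 cosh aᵢ(p)) - yᵢ aᵢ(p))` with gradient `(1 / n) ∑ᵢ (tanh aᵢ(p) - yᵢ) zᵢ`.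
Everything follows from two properties that hold with probability at least `1 - δ`
(`exists_good_event`): the gradient at the true parameter `p₀` is `O(1 / √n)`, and
`(1 / n) ∑ᵢ ⟪zᵢ, v⟫² ≥ κ ‖v‖²` for all `v`.

Both rest on one variance bound, `expect_sq_sum_fluct_le`: a sum of `n` fluctuations
`hᵢ - E[hᵢ | y₋ᵢ]` has second moment `O(n)` as soon as each spin has bounded total influence on the
`hᵢ`. This needs no restriction on the temperature, since only conditional means are subtracted.
For the gradient, take `hᵢ` to be `yᵢ` times a coordinate of `zᵢ`. For the second property, split
`A = G + X W` by least squares (`Admissible.exists_residual`), so that `r = G y` is the part of the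
magnetizations orthogonal to the features; it suffices that `‖r‖² ≥ κ₀ n`
(`Admissible.norm_sq_le_sum_field_sq`). Here take `hⱼ = ∑ᵢ Aᵢⱼ² rᵢ²`. These functions sum to at
most `‖r‖²`, and since the spin `j` moves `rᵢ` by `2 Gᵢⱼ` while both its values have conditional
probability bounded below, the conditional means sum to at least a constant times
`∑ᵢⱼ Aᵢⱼ² Gᵢⱼ²`. Because `G` is entrywise `O(1 / n)`-close to `A`, this is comparable to
`∑ᵢⱼ Aᵢⱼ⁴`, which is of order `n` by the bounds on the Frobenius norm and on the row sums.

On this event the objective is strongly convex on bounded sets. So it has a critical point within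
`O(1 / √n)` of `p₀` (`exists_grad_eq_zero`), which by convexity is the unique maximizer of the
pseudo-likelihood. The gradient is cocoercive with constant `d M² + 4`, which makes each projected
gradient step a contraction towards the estimate, as the latter lies in the box for large `n`.
After `O(ln n)` steps the gradient has norm at most `1 / √n`, and by strong convexity the iterate is
then `O(1 / √n)`-close to the estimate (`Admissible.pgdReturns`).

The running time of an iteration is verified on an explicit program, `RealRAM.iterationCmd`.
-/

noncomputable section

namespace IsingRegression

/-! ### The functions `tanh` and `log (2 cosh)` -/

lemma hasDerivAt_tanh (x : ℝ) : HasDerivAt Real.tanh (1 - Real.tanh x ^ 2) x := by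
  have hc := (Real.cosh_pos x).ne'
  have h := (Real.hasDerivAt_sinh x).div (Real.hasDerivAt_cosh x) hc
  have he : Real.tanh = fun x => Real.sinh x / Real.cosh x :=
    funext fun x => Real.tanh_eq_sinh_div_cosh x
  rw [he]
  refine h.congr_deriv ?_
  field_simp

lemma one_sub_tanh_sq_pos (x : ℝ) : 0 < 1 - Real.tanh x ^ 2 := by
  linarith [Real.tanh_sq_lt_one x]

lemma tanh_strictMono : StrictMono Real.tanh :=
  strictMono_of_deriv_pos fun x => by
    rw [(hasDerivAt_tanh x).deriv]; exact one_sub_tanh_sq_pos x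

lemma tanh_sq_le {x R : ℝ} (h : |x| ≤ R) : Real.tanh x ^ 2 ≤ Real.tanh R ^ 2 := by
  have h1 := tanh_strictMono.monotone (abs_le.1 h).1
  have h2 := tanh_strictMono.monotone (abs_le.1 h).2
  rw [Real.tanh_neg] at h1
  exact sq_le_sq' h1 h2

lemma abs_tanh_le {x R : ℝ} (h : |x| ≤ R) : |Real.tanh x| ≤ Real.tanh R := by
  have h1 := tanh_strictMono.monotone (abs_le.1 h).1
  have h2 := tanh_strictMono.monotone (abs_le.1 h).2
  rw [Real.tanh_neg] at h1
  exact abs_le.2 ⟨h1, h2⟩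

lemma exists_tanh_sub_eq (a b : ℝ) :
    ∃ c, |c| ≤ max |a| |b| ∧
      Real.tanh a - Real.tanh b = (1 - Real.tanh c ^ 2) * (a - b) := by
  have key : ∀ a b : ℝ, a < b → ∃ c, |c| ≤ max |a| |b| ∧
      Real.tanh a - Real.tanh b = (1 - Real.tanh c ^ 2) * (a - b) := by
    intro a b hab
    obtain ⟨c, hc, h⟩ := exists_hasDerivAt_eq_slope Real.tanh (fun x => 1 - Real.tanh x ^ 2) hab
      (fun x _ => (hasDerivAt_tanh x).continuousAt.continuousWithinAt)
      (fun x _ => hasDerivAt_tanh x)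
    refine ⟨c, abs_le_max_abs_abs hc.1.le hc.2.le, ?_⟩
    have : b - a ≠ 0 := (sub_pos.2 hab).ne'
    rw [h]; field_simp; ring
  rcases lt_trichotomy a b with h | h | h
  · exact key a b h
  · exact ⟨a, le_max_left _ _, by simp [h]⟩
  · obtain ⟨c, hc, h⟩ := key b a h
    exact ⟨c, by rwa [max_comm], by linarith⟩

lemma tanh_sub_mul_sub_ge {R a b : ℝ} (ha : |a| ≤ R) (hb : |b| ≤ R) :
    (1 - Real.tanh R ^ 2) * (a - b) ^ 2 ≤ (Real.tanh a - Real.tanh b) * (a - b) := by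
  obtain ⟨c, hc, h⟩ := exists_tanh_sub_eq a b
  have := tanh_sq_le (hc.trans (max_le ha hb))
  rw [h]
  nlinarith [sq_nonneg (a - b)]

lemma abs_tanh_sub_le (a b : ℝ) : |Real.tanh a - Real.tanh b| ≤ |a - b| := by
  obtain ⟨c, -, h⟩ := exists_tanh_sub_eq a b
  rw [h, abs_mul, abs_of_pos (one_sub_tanh_sq_pos c)]
  nlinarith [abs_nonneg (a - b), sq_nonneg (Real.tanh c)]

lemma sq_tanh_sub_le (a b : ℝ) :
    (Real.tanh a - Real.tanh b) ^ 2 ≤ (Real.tanh a - Real.tanh b) * (a - b) := by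
  obtain ⟨c, -, h⟩ := exists_tanh_sub_eq a b
  have h1 := one_sub_tanh_sq_pos c
  rw [h]
  have : 0 ≤ (1 - Real.tanh c ^ 2) * (a - b) ^ 2 * (Real.tanh c ^ 2) := by positivity
  nlinarith

lemma hasDerivAt_log_two_cosh (x : ℝ) :
    HasDerivAt (fun x => Real.log (2 * Real.cosh x)) (Real.tanh x) x := by
  have hc := Real.cosh_pos x
  have h := ((Real.hasDerivAt_cosh x).const_mul 2).log (by positivity)
  refine h.congr_deriv ?_
  rw [Real.tanh_eq_sinh_div_cosh]; field_simp

/-- Strong convexity of `log (2 cosh)` on `[-R, R]`. -/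
lemma log_two_cosh_ge {R a b : ℝ} (ha : |a| ≤ R) (hb : |b| ≤ R) :
    Real.log (2 * Real.cosh a) + Real.tanh a * (b - a) + (1 - Real.tanh R ^ 2) / 2 * (b - a) ^ 2
      ≤ Real.log (2 * Real.cosh b) := by
  set μ := 1 - Real.tanh R ^ 2
  let φ : ℝ → ℝ := fun t => Real.log (2 * Real.cosh (a + t * (b - a)))
    - (t * (Real.tanh a * (b - a)) + μ / 2 * (b - a) ^ 2 * t ^ 2)
  have hφ : ∀ t, HasDerivAt φ (Real.tanh (a + t * (b - a)) * (b - a)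
      - (Real.tanh a * (b - a) + μ / 2 * (b - a) ^ 2 * (2 * t))) t := by
    intro t
    have h1 : HasDerivAt (fun t => a + t * (b - a)) (b - a) t := by
      simpa using ((hasDerivAt_id t).mul_const (b - a)).const_add a
    have h2 := (hasDerivAt_log_two_cosh (a + t * (b - a))).comp t h1
    have h3 : HasDerivAt (fun t : ℝ => t * (Real.tanh a * (b - a)) + μ / 2 * (b - a) ^ 2 * t ^ 2)
        (Real.tanh a * (b - a) + μ / 2 * (b - a) ^ 2 * (2 * t)) t := by
      have := ((hasDerivAt_id t).mul_const (Real.tanh a * (b - a))).add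
        ((hasDerivAt_pow 2 t).const_mul (μ / 2 * (b - a) ^ 2))
      exact this.congr_deriv (by simp)
    exact h2.sub h3
  have hmono : MonotoneOn φ (Set.Icc 0 1) := by
    refine monotoneOn_of_deriv_nonneg (convex_Icc 0 1)
      (fun t _ => (hφ t).continuousAt.continuousWithinAt)
      (fun t _ => (hφ t).differentiableAt.differentiableWithinAt) ?_
    intro t ht
    rw [interior_Icc] at ht
    rw [(hφ t).deriv]
    have hR : |a + t * (b - a)| ≤ R := by
      rw [abs_le] at *
      constructor <;> nlinarith [ht.1, ht.2]
    have h := tanh_sub_mul_sub_ge hR ha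
    have h' : 0 ≤ t * (Real.tanh (a + t * (b - a)) * (b - a)
      - (Real.tanh a * (b - a) + μ / 2 * (b - a) ^ 2 * (2 * t))) := by
      have e : a + t * (b - a) - a = t * (b - a) := by ring
      rw [e] at h
      linarith
    exact nonneg_of_mul_nonneg_right h' ht.1
  have h := hmono (Set.left_mem_Icc.2 zero_le_one) (Set.right_mem_Icc.2 zero_le_one) zero_le_one
  simp only [φ] at h
  have e : a + 1 * (b - a) = b := by ring
  rw [e] at h
  simp only [zero_mul, add_zero] at h
  linarith

/-! ### Flipping one spin -/

section Model

variable {n d : ℕ} {X : Matrix (Fin n) (Fin d) ℝ} {A : Matrix (Fin n) (Fin n) ℝ}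

lemma spin_eq_or (y : Config n) (i : Fin n) : spin y i = 1 ∨ spin y i = -1 := by
  rcases Int.units_eq_one_or (y i) with h | h <;> simp [spin, h]

lemma spin_sq (y : Config n) (i : Fin n) : spin y i ^ 2 = 1 := by
  rcases spin_eq_or y i with h | h <;> simp [h]

lemma abs_spin (y : Config n) (i : Fin n) : |spin y i| = 1 := by
  rcases spin_eq_or y i with h | h <;> simp [h]

/-- The configuration `y` with its `i`-th spin reversed. -/
def flipAt (i : Fin n) (y : Config n) : Config n := Function.update y i (-y i)

lemma flipAt_flipAt (i : Fin n) (y : Config n) : flipAt i (flipAt i y) = y := by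
  simp [flipAt]

lemma spin_flipAt (i : Fin n) (y : Config n) :
    spin (flipAt i y) = spin y + Pi.single i (-2 * spin y i) := by
  ext j
  by_cases h : j = i
  · subst h; simp [flipAt, spin]; ring
  · simp [flipAt, spin, h]

lemma spin_flipAt_self (i : Fin n) (y : Config n) : spin (flipAt i y) i = -spin y i := by
  simp [flipAt, spin]

lemma mulVec_spin_flipAt (G : Matrix (Fin n) (Fin n) ℝ) (l : Fin n) (y : Config n) (i : Fin n) :
    (G *ᵥ spin (flipAt l y)) i = (G *ᵥ spin y) i - 2 * G i l * spin y l := by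
  rw [spin_flipAt, Matrix.mulVec_add, Matrix.mulVec_single]
  simp; ring

lemma abs_mulVec_spin_le (G : Matrix (Fin n) (Fin n) ℝ) (y : Config n) (i : Fin n) :
    |(G *ᵥ spin y) i| ≤ ∑ j, |G i j| := by
  refine (Finset.abs_sum_le_sum_abs (fun j => G i j * spin y j) Finset.univ).trans
    (Finset.sum_le_sum fun j _ => ?_)
  rw [abs_mul, abs_spin, mul_one]

/-- The vector `(xᵢ, 2 mᵢ)` of derivatives of the `i`-th conditional log-odds parameter,
where `mᵢ` is the magnetization at `i`. -/
def feature (X : Matrix (Fin n) (Fin d) ℝ) (A : Matrix (Fin n) (Fin n) ℝ) (y : Config n)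
    (i : Fin n) : Param d :=
  WithLp.toLp 2 (WithLp.toLp 2 (X i), 2 * (A *ᵥ spin y) i)

/-- The local field `θᵀ xᵢ + 2 β mᵢ`: half the conditional log-odds of `yᵢ = 1`. -/
def field (X : Matrix (Fin n) (Fin d) ℝ) (A : Matrix (Fin n) (Fin n) ℝ) (y : Config n)
    (p : Param d) (i : Fin n) : ℝ :=
  inner ℝ (feature X A y i) p

lemma field_eq (y : Config n) (p : Param d) (i : Fin n) :
    field X A y p i = ∑ k, p.fst k * X i k + 2 * p.snd * (A *ᵥ spin y) i := by
  simp only [field, feature, WithLp.prod_inner_apply, PiLp.inner_apply]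
  simp; ring

lemma field_flipAt (l : Fin n) (y : Config n) (p : Param d) (i : Fin n) :
    field X A (flipAt l y) p i = field X A y p i - 4 * p.snd * A i l * spin y l := by
  rw [field_eq, field_eq, mulVec_spin_flipAt]; ring

lemma exponent_flipAt (hA : A.IsSymm) (h0 : ∀ i, A i i = 0) (p : Param d) (y : Config n)
    (i : Fin n) :
    exponent X A p (flipAt i y) = exponent X A p y - 2 * (spin y i * field X A y p i) := by
  have hlin : ∀ u : Fin n → ℝ, ∑ j, u j * spin (flipAt i y) j
      = ∑ j, u j * spin y j - 2 * u i * spin y i := by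
    intro u
    rw [spin_flipAt]
    simp [mul_add, Finset.sum_add_distrib, Pi.single_apply]
    ring
  have hquad : spin (flipAt i y) ⬝ᵥ (A *ᵥ spin (flipAt i y))
      = spin y ⬝ᵥ (A *ᵥ spin y) - 4 * spin y i * (A *ᵥ spin y) i := by
    have hs : ∑ j, spin y j * A j i = (A *ᵥ spin y) i := by
      simp only [Matrix.mulVec, dotProduct]
      exact Finset.sum_congr rfl fun j _ => by rw [hA.apply, mul_comm]
    have e1 : spin (flipAt i y) ⬝ᵥ (A *ᵥ spin (flipAt i y))
      = ∑ j, (A *ᵥ spin (flipAt i y)) j * spin (flipAt i y) j :=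
        Finset.sum_congr rfl fun j _ => mul_comm _ _
    rw [e1, hlin]
    simp only [mulVec_spin_flipAt, h0, sub_mul, Finset.sum_sub_distrib]
    have e2 : ∑ x, 2 * A x i * spin y i * spin y x = 2 * spin y i * (A *ᵥ spin y) i := by
      rw [← hs, Finset.mul_sum]
      exact Finset.sum_congr rfl fun j _ => by ring
    have e3 : ∑ x, (A *ᵥ spin y) x * spin y x = spin y ⬝ᵥ (A *ᵥ spin y) :=
      Finset.sum_congr rfl fun j _ => mul_comm _ _
    rw [e2, e3]; ring
  rw [exponent, exponent, hlin, hquad, field_eq]; ring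

/-! ### The conditional likelihoods -/

lemma sum_exp_exponent_pos (p : Param d) :
    0 < ∑ σ : Config n, Real.exp (exponent X A p σ) :=
  Finset.sum_pos (fun _ _ => Real.exp_pos _) ⟨fun _ => 1, Finset.mem_univ _⟩

lemma law_pos (p : Param d) (y : Config n) : 0 < law X A p y :=
  div_pos (Real.exp_pos _) (sum_exp_exponent_pos p)

lemma sum_law (p : Param d) : ∑ y : Config n, law X A p y = 1 := by
  simp only [law, ← Finset.sum_div]
  exact div_self (sum_exp_exponent_pos p).ne'

lemma law_flipAt (hA : A.IsSymm) (h0 : ∀ i, A i i = 0) (p : Param d) (y : Config n) (i : Fin n) :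
    law X A p (flipAt i y) = law X A p y * Real.exp (-2 * (spin y i * field X A y p i)) := by
  rw [law, law, exponent_flipAt hA h0, sub_eq_add_neg, Real.exp_add]
  rw [neg_mul]; ring

lemma condLik_eq (hA : A.IsSymm) (h0 : ∀ i, A i i = 0) (p : Param d) (y : Config n) (i : Fin n) :
    condLik X A p y i
      = Real.exp (spin y i * field X A y p i) / (2 * Real.cosh (field X A y p i)) := by
  have hsum : ∑ s : ℤˣ, law X A p (Function.update y i s)
      = law X A p y + law X A p (flipAt i y) := by
    have hu : (Finset.univ : Finset ℤˣ) = {1, -1} := rfl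
    rw [hu, Finset.sum_pair (by decide)]
    rcases Int.units_eq_one_or (y i) with h | h
    · rw [flipAt, h]; congr 2; rw [← h, Function.update_eq_self]
    · rw [flipAt, h, neg_neg, add_comm]; congr 2; rw [← h, Function.update_eq_self]
  set a := field X A y p i
  have hc : 2 * Real.cosh a = Real.exp (spin y i * a) + Real.exp (-(spin y i * a)) := by
    rcases spin_eq_or y i with h | h <;> simp [h, Real.cosh_eq]
    · ring
    · ring
  have hl := law_pos (X := X) (A := A) p y
  rw [condLik, hsum, law_flipAt hA h0, hc, div_eq_div_iff (by positivity) (by positivity)]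
  have e : Real.exp (-2 * (spin y i * a))
      = Real.exp (-(spin y i * a)) * Real.exp (-(spin y i * a)) := by
    rw [← Real.exp_add]; ring_nf
  have e1 : Real.exp (spin y i * a) * Real.exp (-(spin y i * a)) = 1 := by
    rw [← Real.exp_add]; simp
  change _ = _ * (_ + _ * Real.exp (-2 * (spin y i * a)))
  rw [e]
  linear_combination (-law X A p y * Real.exp (-(spin y i * a))) * e1

lemma condLik_pos (p : Param d) (y : Config n) (i : Fin n) : 0 < condLik X A p y i :=
  div_pos (law_pos p y) (Finset.sum_pos (fun _ _ => law_pos p _) ⟨1, Finset.mem_univ _⟩)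

lemma PL_pos (y : Config n) (p : Param d) : 0 < PL X A y p :=
  Finset.prod_pos fun i _ => condLik_pos p y i

lemma neg_LPL_eq (hA : A.IsSymm) (h0 : ∀ i, A i i = 0) (y : Config n) (p : Param d) :
    -LPL X A y p = (1 / (n : ℝ)) * ∑ i, (Real.log (2 * Real.cosh (field X A y p i))
      - spin y i * field X A y p i) := by
  rw [LPL, PL, Real.log_prod fun i _ => (condLik_pos p y i).ne', ← mul_neg,
    ← Finset.sum_neg_distrib]
  congr 1
  refine Finset.sum_congr rfl fun i _ => ?_
  have := Real.cosh_pos (field X A y p i)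
  rw [condLik_eq hA h0, Real.log_div (Real.exp_pos _).ne' (by positivity), Real.log_exp]
  ring

lemma isMPLE_iff (hn : 0 < n) (y : Config n) (p : Param d) :
    IsMPLE X A y p ↔ ∀ q, -LPL X A y p ≤ -LPL X A y q := by
  have : (0 : ℝ) < 1 / n := by positivity
  refine forall_congr' fun q => ?_
  rw [neg_le_neg_iff, LPL, LPL, mul_le_mul_iff_right₀ this,
    Real.log_le_log_iff (PL_pos y q) (PL_pos y p)]

/-! ### The gradient of the pseudo-likelihood -/

lemma grad_eq (hA : A.IsSymm) (h0 : ∀ i, A i i = 0) (y : Config n) (p : Param d) :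
    grad X A y p = (1 / (n : ℝ)) •
      ∑ i, (Real.tanh (field X A y p i) - spin y i) • feature X A y i := by
  have hfun : (fun q => -LPL X A y q) = fun q => (1 / (n : ℝ)) *
      ∑ i, (Real.log (2 * Real.cosh (field X A y q i)) - spin y i * field X A y q i) :=
    funext fun q => neg_LPL_eq hA h0 y q
  rw [grad, hfun]
  refine HasGradientAt.gradient ?_
  rw [hasGradientAt_iff_hasFDerivAt]
  have hf : ∀ i, HasFDerivAt (fun q => field X A y q i) (innerSL ℝ (feature X A y i)) p :=
    fun i => (innerSL ℝ (feature X A y i)).hasFDerivAt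
  have h1 := (HasFDerivAt.fun_sum (u := Finset.univ) fun i _ =>
    (((hasDerivAt_log_two_cosh (field X A y p i)).comp_hasFDerivAt p (hf i)).sub
      ((hf i).const_mul (spin y i)))).const_mul (1 / (n : ℝ))
  refine h1.congr_fderiv ?_
  ext v
  simp [sub_mul]

lemma feature_fst (y : Config n) (i : Fin n) (k : Fin d) : (feature X A y i).fst k = X i k := rfl

lemma feature_snd (y : Config n) (i : Fin n) :
    (feature X A y i).snd = 2 * (A *ᵥ spin y) i := rfl

lemma norm_sq_param (v : Param d) : ‖v‖ ^ 2 = ∑ k, v.fst k ^ 2 + v.snd ^ 2 := by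
  rw [WithLp.prod_norm_sq_eq_of_L2, EuclideanSpace.norm_sq_eq]
  simp

lemma grad_fst (hA : A.IsSymm) (h0 : ∀ i, A i i = 0) (y : Config n) (p : Param d) (k : Fin d) :
    (grad X A y p).fst k
      = ∑ i, (Real.tanh (field X A y p i) - spin y i) / n * X i k := by
  rw [grad_eq hA h0]
  have : ∀ (s : Finset (Fin n)) (f : Fin n → Param d),
      (∑ i ∈ s, f i).fst k = ∑ i ∈ s, (f i).fst k := by
    intro s f
    induction s using Finset.cons_induction with
    | empty => simp
    | cons a s ha ih => rw [Finset.sum_cons, Finset.sum_cons, ← ih]; simp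
  simp only [WithLp.smul_fst, PiLp.smul_apply, this, Finset.smul_sum, smul_eq_mul, feature_fst]
  exact Finset.sum_congr rfl fun i _ => by ring

lemma grad_snd (hA : A.IsSymm) (h0 : ∀ i, A i i = 0) (y : Config n) (p : Param d) :
    (grad X A y p).snd
      = ∑ i, (Real.tanh (field X A y p i) - spin y i) / n * (2 * (A *ᵥ spin y) i) := by
  rw [grad_eq hA h0]
  have : ∀ (s : Finset (Fin n)) (f : Fin n → Param d),
      (∑ i ∈ s, f i).snd = ∑ i ∈ s, (f i).snd := by
    intro s f
    induction s using Finset.cons_induction with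
    | empty => simp
    | cons a s ha ih => rw [Finset.sum_cons, Finset.sum_cons, ← ih]; simp
  simp only [WithLp.smul_snd, this, Finset.smul_sum, smul_eq_mul, feature_snd]
  exact Finset.sum_congr rfl fun i _ => by ring

end Model
end IsingRegression

/-! ### Executing loops of the random access machine -/

namespace RealRAM

lemma setMem_mem_of_ne (s : State) {a b : ℕ} (i j : ℕ) (x : ℝ) (h : b ≠ a) :
    (s.setMem a i j x).mem b = s.mem b := by
  funext i' j'; simp [State.setMem, h]

lemma setMem_mem_self (s : State) (a i j i' j' : ℕ) (x : ℝ) :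
    (s.setMem a i j x).mem a i' j' = if i' = i ∧ j' = j then x else s.mem a i' j' := by
  simp [State.setMem]

@[simp] lemma setMem_reg (s : State) (a i j : ℕ) (x : ℝ) : (s.setMem a i j x).reg = s.reg := rfl

@[simp] lemma setReg_mem (s : State) (v k : ℕ) : (s.setReg v k).mem = s.mem := rfl

lemma setReg_reg_self (s : State) (v k : ℕ) : (s.setReg v k).reg v = k := by
  simp [State.setReg]

lemma setReg_reg_of_ne (s : State) {v r : ℕ} (k : ℕ) (h : r ≠ v) :
    (s.setReg v k).reg r = s.reg r := by
  simp [State.setReg, h]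

/-- The invariant rule for loops, with a bound for the running time. -/
lemma runLoop_spec {f : State → State × ℕ} {v : ℕ} {s : State} {N : ℕ} (I : ℕ → State → Prop)
    (cost : ℕ) (h0 : I 0 s)
    (hstep : ∀ k < N, ∀ s', I k s' →
      I (k + 1) (f (s'.setReg v k)).1 ∧ (f (s'.setReg v k)).2 ≤ cost) :
    I N (runLoop f v s N).1 ∧ (runLoop f v s N).2 ≤ N * (cost + 1) + 1 := by
  induction N with
  | zero => exact ⟨h0, by simp [runLoop]⟩
  | succ N ih =>
    obtain ⟨h1, h2⟩ := ih fun k hk => hstep k (hk.trans N.lt_succ_self)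
    obtain ⟨h3, h4⟩ := hstep N N.lt_succ_self _ h1
    refine ⟨h3, ?_⟩
    simp only [runLoop]
    have : (N + 1) * (cost + 1) = N * (cost + 1) + (cost + 1) := by ring
    omega

/-- The states `s` and `s'` agree outside the array `a` and the register `v`. -/
structure SameOff (a v : ℕ) (s s' : State) : Prop where
  mem : ∀ b, b ≠ a → s'.mem b = s.mem b
  reg : ∀ r, r ≠ v → s'.reg r = s.reg r

lemma SameOff.refl (a v : ℕ) (s : State) : SameOff a v s s := ⟨fun _ _ => rfl, fun _ _ => rfl⟩

/-- A loop that writes `F k` into the `k`-th cell of the array `a`. -/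
lemma exec_map_loop {v a : ℕ} {N : Idx} {e : Expr} {s : State} (F : ℕ → ℝ)
    (h : ∀ k < N.eval s, ∀ s', SameOff a v s s' → s'.reg v = k → s'.mem a k 0 = s.mem a k 0 →
      e.eval s' = F k) :
    let r := (Cmd.loop v N (.write a (.var v) (.lit 0) e)).exec s
    SameOff a v s r.1 ∧ (∀ k < N.eval s, r.1.mem a k 0 = F k) ∧
      r.2 ≤ N.eval s * (e.cost + 2) + 1 := by
  intro r
  obtain ⟨⟨h1, h2, -⟩, h3⟩ := runLoop_spec
    (f := (Cmd.write a (.var v) (.lit 0) e).exec) (v := v) (s := s) (N := N.eval s)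
    (fun k s' => SameOff a v s s' ∧ (∀ k' < k, s'.mem a k' 0 = F k') ∧
      ∀ k', k ≤ k' → s'.mem a k' 0 = s.mem a k' 0) (e.cost + 1)
    ⟨SameOff.refl _ _ _, by simp, by simp⟩ (by
      rintro k hk s' ⟨h1, h2, h3⟩
      have he : e.eval (s'.setReg v k) = F k :=
        h k hk _ ⟨fun b hb => h1.mem b hb, fun r hr => by rw [setReg_reg_of_ne _ _ hr, h1.reg r hr]⟩
          (setReg_reg_self _ _ _) (h3 k le_rfl)
      refine ⟨⟨⟨fun b hb => ?_, fun r hr => ?_⟩, fun k' hk' => ?_, fun k' hk' => ?_⟩, le_rfl⟩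
      · simp only [Cmd.exec]; rw [setMem_mem_of_ne _ _ _ _ hb]; exact h1.mem b hb
      · simp only [Cmd.exec, setMem_reg]; rw [setReg_reg_of_ne _ _ hr, h1.reg r hr]
      · simp only [Cmd.exec, Idx.eval, setReg_reg_self, setMem_mem_self, he]
        rcases Nat.lt_succ_iff_lt_or_eq.1 hk' with hlt | rfl
        · simpa [hlt.ne] using h2 k' hlt
        · simp
      · simp only [Cmd.exec, Idx.eval, setReg_reg_self, setMem_mem_self, he]
        have : k' ≠ k := by omega
        simpa [this] using h3 k' (by omega))
  exact ⟨h1, h2, h3⟩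

/-- A loop that adds `∑ₖ F k` to the cell `(0, 0)` of the array `a`. -/
lemma exec_sum_loop {v a : ℕ} {N : Idx} {e : Expr} {s : State} (F : ℕ → ℝ)
    (h : ∀ k < N.eval s, ∀ s', SameOff a v s s' → s'.reg v = k → e.eval s' = F k) :
    let r := (Cmd.loop v N
      (.write a (.lit 0) (.lit 0) (.add (.read a (.lit 0) (.lit 0)) e))).exec s
    SameOff a v s r.1 ∧ r.1.mem a 0 0 = s.mem a 0 0 + ∑ k ∈ Finset.range (N.eval s), F k ∧
      r.2 ≤ N.eval s * (e.cost + 4) + 1 := by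
  intro r
  obtain ⟨⟨h1, h2⟩, h3⟩ := runLoop_spec
    (f := (Cmd.write a (.lit 0) (.lit 0) (.add (.read a (.lit 0) (.lit 0)) e)).exec)
    (v := v) (s := s) (N := N.eval s)
    (fun k s' => SameOff a v s s' ∧ s'.mem a 0 0 = s.mem a 0 0 + ∑ k ∈ Finset.range k, F k)
    (e.cost + 3) ⟨SameOff.refl _ _ _, by simp⟩ (by
      rintro k hk s' ⟨h1, h2⟩
      have he : e.eval (s'.setReg v k) = F k :=
        h k hk _ ⟨fun b hb => h1.mem b hb, fun r hr => by rw [setReg_reg_of_ne _ _ hr, h1.reg r hr]⟩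
          (setReg_reg_self _ _ _)
      refine ⟨⟨⟨fun b hb => ?_, fun r hr => ?_⟩, ?_⟩, ?_⟩
      · simp only [Cmd.exec]; rw [setMem_mem_of_ne _ _ _ _ hb]; exact h1.mem b hb
      · simp only [Cmd.exec, setMem_reg]; rw [setReg_reg_of_ne _ _ hr, h1.reg r hr]
      · simp only [Cmd.exec, Idx.eval, setMem_mem_self, Expr.eval, he, setReg_mem, h2]
        rw [Finset.sum_range_succ]; simp [add_assoc]
      · simp only [Cmd.exec, Expr.cost]; omega)
  exact ⟨h1, h2, h3⟩

/-! ### The program for one iteration of projected gradient descent -/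

/-- `min` of two expressions, by `min x y = (x + y - √((x - y)²)) / 2`. -/
def Expr.min (e₁ e₂ : Expr) : Expr :=
  .mul (.const (1 / 2)) (.sub (.add e₁ e₂) (.sqrt (.mul (.sub e₁ e₂) (.sub e₁ e₂))))

/-- `max` of two expressions, by `max x y = (x + y + √((x - y)²)) / 2`. -/
def Expr.max (e₁ e₂ : Expr) : Expr :=
  .mul (.const (1 / 2)) (.add (.add e₁ e₂) (.sqrt (.mul (.sub e₁ e₂) (.sub e₁ e₂))))

lemma Expr.eval_min (s : State) (e₁ e₂ : Expr) :
    (Expr.min e₁ e₂).eval s = Min.min (e₁.eval s) (e₂.eval s) := by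
  simp only [Expr.min, Expr.eval, Real.sqrt_mul_self_eq_abs]
  rcases le_total (e₁.eval s) (e₂.eval s) with h | h
  · rw [min_eq_left h, abs_of_nonpos (sub_nonpos.2 h)]; push_cast; ring
  · rw [min_eq_right h, abs_of_nonneg (sub_nonneg.2 h)]; push_cast; ring

lemma Expr.eval_max (s : State) (e₁ e₂ : Expr) :
    (Expr.max e₁ e₂).eval s = Max.max (e₁.eval s) (e₂.eval s) := by
  simp only [Expr.max, Expr.eval, Real.sqrt_mul_self_eq_abs]
  rcases le_total (e₁.eval s) (e₂.eval s) with h | h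
  · rw [max_eq_right h, abs_of_nonpos (sub_nonpos.2 h)]; push_cast; ring
  · rw [max_eq_left h, abs_of_nonneg (sub_nonneg.2 h)]; push_cast; ring

/-- The projection of `e` to `[-b, b]`. -/
def Expr.clamp (b e : Expr) : Expr := .max (.sub (.const 0) b) (.min b e)

lemma Expr.eval_clamp (s : State) (b e : Expr) :
    (Expr.clamp b e).eval s = Max.max (-b.eval s) (Min.min (b.eval s) (e.eval s)) := by
  rw [Expr.clamp, Expr.eval_max, Expr.eval_min]; simp [Expr.eval]

/-- The cell `(0, 0)` of the array `a`. -/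
def Expr.cell (a : ℕ) : Expr := .read a (.lit 0) (.lit 0)

/-- Adds the contribution of the observation whose number is in the register `2` to the gradient
with respect to `θ` in the array `5` and to the derivative with respect to `β` in the cell
`(0, 0)` of the array `6`; the array `7` holds first the local field and then the residual. -/
def rowCmd : Cmd :=
  .seq (.write 7 (.lit 0) (.lit 0)
    (.mul (.mul (.const 2) (.read 4 (.lit 0) (.lit 0))) (.read 1 (.var 2) (.lit 0)))) <|
  .seq (.loop 3 (.var 1) (.write 7 (.lit 0) (.lit 0) (.add (.read 7 (.lit 0) (.lit 0))
    (.mul (.read 3 (.var 3) (.lit 0)) (.read 2 (.var 2) (.var 3)))))) <|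
  .seq (.write 7 (.lit 0) (.lit 0)
    (.div (.sub (.tanh (.cell 7)) (.read 0 (.var 2) (.lit 0))) (.ofIdx (.var 0)))) <|
  .seq (.loop 3 (.var 1) (.write 5 (.var 3) (.lit 0)
    (.add (.read 5 (.var 3) (.lit 0)) (.mul (.cell 7) (.read 2 (.var 2) (.var 3)))))) <|
  .write 6 (.lit 0) (.lit 0)
    (.add (.cell 6) (.mul (.cell 7) (.mul (.const 2) (.read 1 (.var 2) (.lit 0)))))

/-- Computes the gradient into the arrays `5` and `6`. -/
def gradCmd : Cmd :=
  .seq (.loop 2 (.var 1) (.write 5 (.var 2) (.lit 0) (.const 0))) <|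
  .seq (.write 6 (.lit 0) (.lit 0) (.const 0)) <|
  .loop 2 (.var 0) rowCmd

/-- Computes the norm of the gradient. -/
def normCmd : Cmd :=
  .seq (.write 8 (.lit 0) (.lit 0) (.mul (.cell 6) (.cell 6))) <|
  .seq (.loop 2 (.var 1) (.write 8 (.lit 0) (.lit 0) (.add (.read 8 (.lit 0) (.lit 0))
    (.mul (.read 5 (.var 2) (.lit 0)) (.read 5 (.var 2) (.lit 0)))))) <|
  .write 4 (.lit 4) (.lit 0) (.sqrt (.cell 8))

/-- Takes a step along the negative gradient and projects to the box. -/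
def stepCmd : Cmd :=
  .seq (.loop 2 (.var 1) (.write 3 (.var 2) (.lit 0)
    (.clamp (.read 4 (.lit 1) (.lit 0)) (.sub (.read 3 (.var 2) (.lit 0))
      (.mul (.read 4 (.lit 3) (.lit 0)) (.read 5 (.var 2) (.lit 0))))))) <|
  .write 4 (.lit 0) (.lit 0) (.clamp (.read 4 (.lit 2) (.lit 0))
    (.sub (.cell 4) (.mul (.read 4 (.lit 3) (.lit 0)) (.cell 6))))

/-- One iteration of projected gradient descent. -/
def iterationCmd : Cmd := .seq gradCmd (.seq normCmd stepCmd)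

/-- The local field at the observation `i`, computed from the memory. -/
def State.localField (s : State) (i : ℕ) : ℝ :=
  2 * s.mem 4 0 0 * s.mem 1 i 0 + ∑ k ∈ Finset.range (s.reg 1), s.mem 3 k 0 * s.mem 2 i k

/-- The weight of the observation `i` in the gradient, computed from the memory. -/
def State.residual (s : State) (i : ℕ) : ℝ :=
  (Real.tanh (s.localField i) - s.mem 0 i 0) / s.reg 0

lemma State.residual_congr {s s' : State} (hm : ∀ a < 5, s'.mem a = s.mem a)
    (h0 : s'.reg 0 = s.reg 0) (h1 : s'.reg 1 = s.reg 1) (i : ℕ) :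
    s'.residual i = s.residual i := by
  simp only [State.residual, State.localField, h0, h1, hm 0 (by norm_num), hm 1 (by norm_num),
    hm 2 (by norm_num), hm 3 (by norm_num), hm 4 (by norm_num)]

lemma exec_rowCmd (s : State) :
    let r := rowCmd.exec s
    (∀ a < 5, r.1.mem a = s.mem a) ∧ (∀ v, v ≠ 3 → r.1.reg v = s.reg v) ∧
      (∀ k < s.reg 1, r.1.mem 5 k 0 = s.mem 5 k 0 + s.residual (s.reg 2) * s.mem 2 (s.reg 2) k) ∧
      r.1.mem 6 0 0 = s.mem 6 0 0 + s.residual (s.reg 2) * (2 * s.mem 1 (s.reg 2) 0) ∧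
      r.2 ≤ 14 * s.reg 1 + 24 := by
  simp only [rowCmd, Cmd.exec.eq_3]
  generalize hs1 : Cmd.exec (Cmd.write 7 _ _ _) s = r1
  have m1 : ∀ b, b ≠ 7 → r1.1.mem b = s.mem b := fun b hb => by
    rw [← hs1]; exact setMem_mem_of_ne _ _ _ _ hb
  have g1 : r1.1.reg = s.reg := by rw [← hs1]; rfl
  have v1 : r1.1.mem 7 0 0 = 2 * s.mem 4 0 0 * s.mem 1 (s.reg 2) 0 := by
    rw [← hs1]; simp [Cmd.exec, setMem_mem_self, Idx.eval, Expr.eval]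
  have c1 : r1.2 = 6 := by rw [← hs1]; rfl
  obtain ⟨o2, v2, c2⟩ := exec_sum_loop (v := 3) (a := 7) (N := .var 1) (s := r1.1)
    (e := .mul (.read 3 (.var 3) (.lit 0)) (.read 2 (.var 2) (.var 3)))
    (fun k => s.mem 3 k 0 * s.mem 2 (s.reg 2) k) (by
      intro k _ s' h hk
      simp only [Expr.eval, Idx.eval, hk, h.mem 3 (by norm_num), h.mem 2 (by norm_num),
        h.reg 2 (by norm_num), m1 3 (by norm_num), m1 2 (by norm_num), g1])
  generalize Cmd.exec (Cmd.loop 3 _ _) r1.1 = r2 at o2 v2 c2 ⊢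
  have v2' : r2.1.mem 7 0 0 = s.localField (s.reg 2) := by
    rw [v2, v1, State.localField]; simp [Idx.eval, g1]
  have m2 : ∀ b, b ≠ 7 → r2.1.mem b = s.mem b := fun b hb => by rw [o2.mem b hb, m1 b hb]
  have g2 : ∀ v, v ≠ 3 → r2.1.reg v = s.reg v := fun v hv => by rw [o2.reg v hv, g1]
  generalize hs3 : Cmd.exec (Cmd.write 7 _ _ _) r2.1 = r3
  have m3 : ∀ b, b ≠ 7 → r3.1.mem b = s.mem b := fun b hb => by
    rw [← hs3, ← m2 b hb]; exact setMem_mem_of_ne _ _ _ _ hb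
  have g3 : ∀ v, v ≠ 3 → r3.1.reg v = s.reg v := fun v hv => by rw [← hs3, ← g2 v hv]; rfl
  have v3 : r3.1.mem 7 0 0 = s.residual (s.reg 2) := by
    rw [← hs3]
    simp only [Cmd.exec, setMem_mem_self, Idx.eval, Expr.eval, Expr.cell, v2', m2 0 (by norm_num),
      g2 2 (by norm_num), g2 0 (by norm_num), State.residual]
    simp
  have c3 : r3.2 = 7 := by rw [← hs3]; rfl
  obtain ⟨o4, v4, c4⟩ := exec_map_loop (v := 3) (a := 5) (N := .var 1) (s := r3.1)
    (e := .add (.read 5 (.var 3) (.lit 0)) (.mul (.cell 7) (.read 2 (.var 2) (.var 3))))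
    (fun k => s.mem 5 k 0 + s.residual (s.reg 2) * s.mem 2 (s.reg 2) k) (by
      intro k _ s' h hk h5
      simp only [Expr.eval, Idx.eval, Expr.cell, hk, h5, h.mem 7 (by norm_num),
        h.mem 2 (by norm_num), h.reg 2 (by norm_num), m3 5 (by norm_num), m3 2 (by norm_num),
        g3 2 (by norm_num), v3])
  generalize Cmd.exec (Cmd.loop 3 _ _) r3.1 = r4 at o4 v4 c4 ⊢
  have g4 : ∀ v, v ≠ 3 → r4.1.reg v = s.reg v := fun v hv => by rw [o4.reg v hv, g3 v hv]
  have m4 : ∀ b, b ≠ 5 → b ≠ 7 → r4.1.mem b = s.mem b := fun b hb hb' => by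
    rw [o4.mem b hb, m3 b hb']
  have v4' : r4.1.mem 7 0 0 = s.residual (s.reg 2) := by rw [o4.mem 7 (by norm_num), v3]
  generalize hs5 : Cmd.exec (Cmd.write 6 _ _ _) r4.1 = r5
  have c5 : r5.2 = 8 := by rw [← hs5]; rfl
  have m5 : ∀ b, b ≠ 6 → r5.1.mem b = r4.1.mem b := fun b hb => by
    rw [← hs5]; exact setMem_mem_of_ne _ _ _ _ hb
  refine ⟨fun a ha => ?_, fun v hv => ?_, fun k hk => ?_, ?_, ?_⟩
  · rw [m5 a (by omega), m4 a (by omega) (by omega)]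
  · rw [← g4 v hv, ← hs5]; rfl
  · rw [m5 5 (by norm_num)]; exact v4 k (by simpa [Idx.eval, g3] using hk)
  · rw [← hs5]
    simp only [Cmd.exec, setMem_mem_self, Idx.eval, Expr.eval, Expr.cell, v4',
      m4 6 (by norm_num) (by norm_num), m4 1 (by norm_num) (by norm_num), g4 2 (by norm_num)]
    simp
  · simp only [Idx.eval, g1, g3 1 (by norm_num), Expr.cost, Expr.cell] at c2 c4
    omega

lemma exec_gradCmd (s : State) :
    let r := gradCmd.exec s
    (∀ a < 5, r.1.mem a = s.mem a) ∧ r.1.reg 0 = s.reg 0 ∧ r.1.reg 1 = s.reg 1 ∧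
      (∀ k < s.reg 1, r.1.mem 5 k 0 = ∑ i ∈ Finset.range (s.reg 0), s.residual i * s.mem 2 i k) ∧
      r.1.mem 6 0 0 = ∑ i ∈ Finset.range (s.reg 0), s.residual i * (2 * s.mem 1 i 0) ∧
      r.2 ≤ s.reg 0 * (14 * s.reg 1 + 25) + 3 * s.reg 1 + 4 := by
  simp only [gradCmd, Cmd.exec.eq_3]
  obtain ⟨o1, v1, c1⟩ := exec_map_loop (v := 2) (a := 5) (N := .var 1) (s := s)
    (e := .const 0) (fun _ => 0) (by intro k _ s' _ _ _; simp [Expr.eval])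
  generalize Cmd.exec (Cmd.loop 2 _ (Cmd.write _ _ _ _)) s = r1 at o1 v1 c1 ⊢
  generalize hs2 : Cmd.exec (Cmd.write 6 _ _ _) r1.1 = r2
  have m2 : ∀ b, b ≠ 6 → r2.1.mem b = r1.1.mem b := fun b hb => by
    rw [← hs2]; exact setMem_mem_of_ne _ _ _ _ hb
  have v2 : r2.1.mem 6 0 0 = 0 := by
    rw [← hs2]; simp [Cmd.exec, setMem_mem_self, Idx.eval, Expr.eval]
  have g2 : ∀ v, v ≠ 2 → r2.1.reg v = s.reg v := fun v hv => by rw [← o1.reg v hv, ← hs2]; rfl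
  have c2 : r2.2 = 2 := by rw [← hs2]; rfl
  obtain ⟨⟨m3, g30, g31, v35, v36⟩, c3⟩ := runLoop_spec (f := rowCmd.exec) (v := 2) (s := r2.1)
    (N := s.reg 0)
    (fun i s' => (∀ a < 5, s'.mem a = s.mem a) ∧ s'.reg 0 = s.reg 0 ∧ s'.reg 1 = s.reg 1 ∧
      (∀ k < s.reg 1, s'.mem 5 k 0 = ∑ i ∈ Finset.range i, s.residual i * s.mem 2 i k) ∧
      s'.mem 6 0 0 = ∑ i ∈ Finset.range i, s.residual i * (2 * s.mem 1 i 0))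
    (14 * s.reg 1 + 24)
    ⟨fun a ha => by rw [m2 a (by omega), o1.mem a (by omega)], g2 0 (by norm_num),
      g2 1 (by norm_num), fun k hk => by rw [m2 5 (by norm_num)]; simpa using v1 k hk,
      by simpa using v2⟩ (by
      rintro i hi s' ⟨h1, h2, h3, h4, h5⟩
      obtain ⟨q1, q2, q3, q4, q5⟩ := exec_rowCmd (s'.setReg 2 i)
      have hr0 : (s'.setReg 2 i).reg 0 = s.reg 0 := by
        rw [setReg_reg_of_ne _ _ (by norm_num), h2]
      have hr1 : (s'.setReg 2 i).reg 1 = s.reg 1 := by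
        rw [setReg_reg_of_ne _ _ (by norm_num), h3]
      have hres : (s'.setReg 2 i).residual i = s.residual i :=
        State.residual_congr (fun a ha => h1 a ha) hr0 hr1 i
      rw [setReg_reg_self, hres, setReg_mem] at q3 q4
      rw [hr1] at q3 q5
      refine ⟨⟨fun a ha => ?_, ?_, ?_, fun k hk => ?_, ?_⟩, q5⟩
      · rw [q1 a ha]; exact h1 a ha
      · rw [q2 0 (by norm_num), hr0]
      · rw [q2 1 (by norm_num), hr1]
      · rw [q3 k hk, h4 k hk, h1 2 (by norm_num), Finset.sum_range_succ]
      · rw [q4, h5, h1 1 (by norm_num), Finset.sum_range_succ])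
  have e3 : (Cmd.loop 2 (.var 0) rowCmd).exec r2.1 = runLoop rowCmd.exec 2 r2.1 (s.reg 0) := by
    rw [Cmd.exec]; simp only [Idx.eval, g2 0 (by norm_num)]
  rw [e3]
  refine ⟨m3, g30, g31, v35, v36, ?_⟩
  simp only [Idx.eval, Expr.cost] at c1
  have : 14 * s.reg 1 + 24 + 1 = 14 * s.reg 1 + 25 := rfl
  rw [this] at c3
  omega

lemma exec_normCmd (s : State) :
    let r := normCmd.exec s
    (∀ a < 7, a ≠ 4 → r.1.mem a = s.mem a) ∧ (∀ i < 4, r.1.mem 4 i 0 = s.mem 4 i 0) ∧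
      r.1.reg 0 = s.reg 0 ∧ r.1.reg 1 = s.reg 1 ∧
      r.1.mem 4 4 0
        = √(s.mem 6 0 0 ^ 2 + ∑ k ∈ Finset.range (s.reg 1), s.mem 5 k 0 ^ 2) ∧
      r.2 ≤ 7 * s.reg 1 + 8 := by
  simp only [normCmd, Cmd.exec.eq_3]
  generalize hs1 : Cmd.exec (Cmd.write 8 _ _ _) s = r1
  have m1 : ∀ b, b ≠ 8 → r1.1.mem b = s.mem b := fun b hb => by
    rw [← hs1]; exact setMem_mem_of_ne _ _ _ _ hb
  have g1 : r1.1.reg = s.reg := by rw [← hs1]; rfl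
  have v1 : r1.1.mem 8 0 0 = s.mem 6 0 0 ^ 2 := by
    rw [← hs1]; simp [Cmd.exec, setMem_mem_self, Idx.eval, Expr.eval, Expr.cell, sq]
  have c1 : r1.2 = 4 := by rw [← hs1]; rfl
  obtain ⟨o2, v2, c2⟩ := exec_sum_loop (v := 2) (a := 8) (N := .var 1) (s := r1.1)
    (e := .mul (.read 5 (.var 2) (.lit 0)) (.read 5 (.var 2) (.lit 0)))
    (fun k => s.mem 5 k 0 ^ 2) (by
      intro k _ s' h hk
      simp only [Expr.eval, Idx.eval, hk, h.mem 5 (by norm_num), m1 5 (by norm_num), sq])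
  generalize Cmd.exec (Cmd.loop 2 _ _) r1.1 = r2 at o2 v2 c2 ⊢
  have m2 : ∀ b, b ≠ 8 → r2.1.mem b = s.mem b := fun b hb => by rw [o2.mem b hb, m1 b hb]
  generalize hs3 : Cmd.exec (Cmd.write 4 _ _ _) r2.1 = r3
  have c3 : r3.2 = 3 := by rw [← hs3]; rfl
  refine ⟨fun a ha h4 => ?_, fun i hi => ?_, ?_, ?_, ?_, ?_⟩
  · rw [← hs3, ← m2 a (by omega)]; exact setMem_mem_of_ne _ _ _ _ h4
  · rw [← hs3, ← m2 4 (by omega)]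
    simp only [Cmd.exec, setMem_mem_self, Idx.eval]
    simp [hi.ne]
  · rw [← hs3, ← g1, ← o2.reg 0 (by norm_num)]; rfl
  · rw [← hs3, ← g1, ← o2.reg 1 (by norm_num)]; rfl
  · rw [← hs3]
    simp only [Cmd.exec, setMem_mem_self, Idx.eval, Expr.eval, Expr.cell, v2, v1, g1]
    simp
  · simp only [Idx.eval, g1, Expr.cost] at c2
    omega

lemma exec_stepCmd (s : State) :
    let r := stepCmd.exec s
    (∀ a < 3, r.1.mem a = s.mem a) ∧ (∀ i, i ≠ 0 → r.1.mem 4 i 0 = s.mem 4 i 0) ∧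
      r.1.reg 0 = s.reg 0 ∧ r.1.reg 1 = s.reg 1 ∧
      (∀ k < s.reg 1, r.1.mem 3 k 0 = max (-s.mem 4 1 0)
        (min (s.mem 4 1 0) (s.mem 3 k 0 - s.mem 4 3 0 * s.mem 5 k 0))) ∧
      r.1.mem 4 0 0 = max (-s.mem 4 2 0)
        (min (s.mem 4 2 0) (s.mem 4 0 0 - s.mem 4 3 0 * s.mem 6 0 0)) ∧
      r.2 ≤ 100 * s.reg 1 + 101 := by
  simp only [stepCmd, Cmd.exec.eq_3]
  obtain ⟨o1, v1, c1⟩ := exec_map_loop (v := 2) (a := 3) (N := .var 1) (s := s)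
    (e := .clamp (.read 4 (.lit 1) (.lit 0)) (.sub (.read 3 (.var 2) (.lit 0))
      (.mul (.read 4 (.lit 3) (.lit 0)) (.read 5 (.var 2) (.lit 0)))))
    (fun k => max (-s.mem 4 1 0)
        (min (s.mem 4 1 0) (s.mem 3 k 0 - s.mem 4 3 0 * s.mem 5 k 0))) (by
      intro k _ s' h hk h3
      simp only [Expr.eval_clamp, Expr.eval, Idx.eval, hk, h3, h.mem 4 (by norm_num),
        h.mem 5 (by norm_num)])
  generalize Cmd.exec (Cmd.loop 2 _ _) s = r1 at o1 v1 c1 ⊢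
  generalize hs2 : Cmd.exec (Cmd.write 4 _ _ _) r1.1 = r2
  have m2 : ∀ b, b ≠ 4 → r2.1.mem b = r1.1.mem b := fun b hb => by
    rw [← hs2]; exact setMem_mem_of_ne _ _ _ _ hb
  have c2 : r2.2 ≤ 100 := by rw [← hs2]; simp only [Cmd.exec]; decide
  refine ⟨fun a ha => ?_, fun i hi => ?_, ?_, ?_, fun k hk => ?_, ?_, ?_⟩
  · rw [m2 a (by omega), o1.mem a (by omega)]
  · rw [← hs2, ← o1.mem 4 (by norm_num)]
    simp only [Cmd.exec, setMem_mem_self, Idx.eval]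
    simp [hi]
  · rw [← hs2, ← o1.reg 0 (by norm_num)]; rfl
  · rw [← hs2, ← o1.reg 1 (by norm_num)]; rfl
  · rw [m2 3 (by norm_num)]; exact v1 k hk
  · rw [← hs2]
    simp only [Cmd.exec, setMem_mem_self, Idx.eval, Expr.eval, Expr.eval_clamp, Expr.cell,
      o1.mem 4 (by norm_num), o1.mem 6 (by norm_num)]
    simp
  · have hc : (Expr.clamp (.read 4 (.lit 1) (.lit 0)) (.sub (.read 3 (.var 2) (.lit 0))
      (.mul (.read 4 (.lit 3) (.lit 0)) (.read 5 (.var 2) (.lit 0))))).cost ≤ 98 := by decide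
    simp only [Idx.eval] at c1
    have := Nat.mul_le_mul_left (s.reg 1) (Nat.add_le_add_right hc 2)
    omega

end RealRAM

namespace IsingRegression
open RealRAM

lemma exec_iterationCmd {n d : ℕ} (hn : 0 < n) (hd : 0 < d) {X : Matrix (Fin n) (Fin d) ℝ}
    {A : Matrix (Fin n) (Fin n) ℝ} (hA : A.IsSymm) (h0 : ∀ i, A i i = 0) {y : Config n}
    {Θ B η : ℝ} {p : Param d} {s : State} (hs : Encodes X A y Θ B η p s) :
    Encodes X A y Θ B η (pgdStep X A y Θ B η p) (iterationCmd.exec s).1 ∧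
      (iterationCmd.exec s).1.mem 4 4 0 = ‖grad X A y p‖ ∧
      (iterationCmd.exec s).2 ≤ 400 * (d * n) := by
  have hfield : ∀ i : Fin n, s.localField i = field X A y p i := by
    intro i
    rw [field_eq, State.localField, hs.reg_d, Finset.sum_range, hs.mem_β, hs.mem_m, add_comm]
    congr 1
    exact Finset.sum_congr rfl fun k _ => by rw [hs.mem_θ, hs.mem_X]
  have hres : ∀ i : Fin n, s.residual i = (Real.tanh (field X A y p i) - spin y i) / n := by
    intro i; rw [State.residual, hfield, hs.mem_y, hs.reg_n]
  simp only [iterationCmd, Cmd.exec.eq_3]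
  obtain ⟨m1, r10, r11, v15, v16, c1⟩ := exec_gradCmd s
  generalize Cmd.exec gradCmd s = t1 at *
  have hg1 : ∀ k : Fin d, t1.1.mem 5 k 0 = (grad X A y p).fst k := by
    intro k
    rw [v15 k (by rw [hs.reg_d]; exact k.2), hs.reg_n, Finset.sum_range, grad_fst hA h0]
    exact Finset.sum_congr rfl fun i _ => by rw [hres, hs.mem_X]
  have hg2 : t1.1.mem 6 0 0 = (grad X A y p).snd := by
    rw [v16, hs.reg_n, Finset.sum_range, grad_snd hA h0]
    exact Finset.sum_congr rfl fun i _ => by rw [hres, hs.mem_m]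
  obtain ⟨m2, m24, r20, r21, v2, c2⟩ := exec_normCmd t1.1
  generalize Cmd.exec normCmd t1.1 = t2 at *
  obtain ⟨m3, m34, r30, r31, v33, v34, c3⟩ := exec_stepCmd t2.1
  generalize Cmd.exec stepCmd t2.1 = t3 at *
  have h4 : ∀ i < 4, t2.1.mem 4 i 0 = s.mem 4 i 0 := fun i hi => by
    rw [m24 i hi, m1 4 (by norm_num)]
  have h012 : ∀ a < 3, t3.1.mem a = s.mem a := fun a ha => by
    rw [m3 a ha, m2 a (by omega) (by omega), m1 a (by omega)]
  refine ⟨⟨?_, ?_, ?_, ?_, ?_, ?_, ?_, ?_, ?_, ?_⟩, ?_, ?_⟩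
  · rw [r30, r20, r10, hs.reg_n]
  · rw [r31, r21, r11, hs.reg_d]
  · intro i; rw [h012 0 (by norm_num), hs.mem_y]
  · intro i; rw [h012 1 (by norm_num), hs.mem_m]
  · intro i k; rw [h012 2 (by norm_num), hs.mem_X]
  · intro k
    rw [v33 k (by rw [r21, r11, hs.reg_d]; exact k.2), h4 1 (by norm_num), h4 3 (by norm_num),
      m2 3 (by norm_num) (by norm_num), m1 3 (by norm_num), m2 5 (by norm_num) (by norm_num),
      hg1, hs.mem_θ, hs.mem_Θ, hs.mem_η]
    simp [pgdStep, projBox]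
  · rw [v34, h4 2 (by norm_num), h4 0 (by norm_num), h4 3 (by norm_num),
      m2 6 (by norm_num) (by norm_num), hg2, hs.mem_β, hs.mem_B, hs.mem_η]
    simp [pgdStep, projBox]
  · rw [m34 1 (by norm_num), h4 1 (by norm_num), hs.mem_Θ]
  · rw [m34 2 (by norm_num), h4 2 (by norm_num), hs.mem_B]
  · rw [m34 3 (by norm_num), h4 3 (by norm_num), hs.mem_η]
  · rw [m34 4 (by norm_num), v2, r11, hs.reg_d, Finset.sum_range, hg2]
    simp only [hg1]
    rw [add_comm, ← norm_sq_param, Real.sqrt_sq (norm_nonneg _)]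
  · rw [r21, r11, hs.reg_d] at c3
    rw [r11, hs.reg_d] at c2
    rw [hs.reg_n, hs.reg_d] at c1
    have h1 : 1 ≤ d * n := Nat.mul_pos hd hn
    have h2 : d ≤ d * n := Nat.le_mul_of_pos_right d hn
    have h3 : n ≤ d * n := Nat.le_mul_of_pos_left n hd
    have h5 : n * (14 * d + 25) = 14 * (d * n) + 25 * n := by ring
    omega

lemma performsIteration_iterationCmd : PerformsIteration iterationCmd 400 :=
  fun _ _ hn hd _ _ hA h0 _ _ _ _ _ _ hs => exec_iterationCmd hn hd hA h0 hs

section Model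

variable {n d : ℕ} {X : Matrix (Fin n) (Fin d) ℝ} {A : Matrix (Fin n) (Fin n) ℝ}

/-! ### Fluctuations around conditional expectations -/

/-- The expectation of `F` under the model with parameter `p`. -/
def expect (X : Matrix (Fin n) (Fin d) ℝ) (A : Matrix (Fin n) (Fin n) ℝ) (p : Param d)
    (F : Config n → ℝ) : ℝ :=
  ∑ y, law X A p y * F y

lemma expect_mono {p : Param d} {F G : Config n → ℝ} (h : ∀ y, F y ≤ G y) :
    expect X A p F ≤ expect X A p G :=
  Finset.sum_le_sum fun y _ => mul_le_mul_of_nonneg_left (h y) (law_pos p y).le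

lemma expect_const (p : Param d) (c : ℝ) : expect X A p (fun _ => c) = c := by
  rw [expect, ← Finset.sum_mul, sum_law, one_mul]

lemma expect_add (p : Param d) (F G : Config n → ℝ) :
    expect X A p (fun y => F y + G y) = expect X A p F + expect X A p G := by
  simp only [expect, mul_add, Finset.sum_add_distrib]

lemma expect_const_mul (p : Param d) (c : ℝ) (F : Config n → ℝ) :
    expect X A p (fun y => c * F y) = c * expect X A p F := by
  simp only [expect, Finset.mul_sum]
  exact Finset.sum_congr rfl fun y _ => by ring

lemma expect_sum {ι : Type*} (s : Finset ι) (p : Param d) (F : ι → Config n → ℝ) :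
    expect X A p (fun y => ∑ i ∈ s, F i y) = ∑ i ∈ s, expect X A p (F i) := by
  simp only [expect, Finset.mul_sum]
  exact Finset.sum_comm

/-- Markov's inequality: an event whose complement forces `1 ≤ V` has probability at least
`1 - E V`. -/
lemma one_sub_expect_le_prob {p : Param d} {E : Set (Config n)} {V : Config n → ℝ}
    (hV : ∀ y, 0 ≤ V y) (h : ∀ y, y ∉ E → 1 ≤ V y) : 1 - expect X A p V ≤ prob X A p E := by
  have h1 : 1 - expect X A p V = ∑ y, law X A p y * (1 - V y) := by
    simp only [mul_sub, mul_one, Finset.sum_sub_distrib, sum_law, expect]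
  rw [h1, prob]
  refine Finset.sum_le_sum fun y _ => ?_
  have hl := law_pos (X := X) (A := A) p y
  by_cases hy : y ∈ E
  · rw [Set.indicator_of_mem hy]; nlinarith [hV y]
  · rw [Set.indicator_of_notMem hy]; nlinarith [h y hy]

/-- The conditional probability that the spin at `i` takes the value opposite to `yᵢ`. -/
def flipProb (X : Matrix (Fin n) (Fin d) ℝ) (A : Matrix (Fin n) (Fin n) ℝ) (p : Param d)
    (i : Fin n) (y : Config n) : ℝ :=
  (1 - spin y i * Real.tanh (field X A y p i)) / 2

/-- The difference of `F` and its conditional expectation given all spins but the `i`-th. -/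
def fluct (X : Matrix (Fin n) (Fin d) ℝ) (A : Matrix (Fin n) (Fin n) ℝ) (p : Param d)
    (i : Fin n) (F : Config n → ℝ) (y : Config n) : ℝ :=
  flipProb X A p i y * (F y - F (flipAt i y))

lemma abs_spin_mul_tanh (p : Param d) (i : Fin n) (y : Config n) :
    |spin y i * Real.tanh (field X A y p i)| = |Real.tanh (field X A y p i)| := by
  rw [abs_mul, abs_spin, one_mul]

lemma flipProb_nonneg (p : Param d) (i : Fin n) (y : Config n) : 0 ≤ flipProb X A p i y := by
  have h := abs_spin_mul_tanh (X := X) (A := A) p i y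
  have := abs_le.1 (h.le.trans (Real.abs_tanh_lt_one _).le)
  rw [flipProb]; linarith

lemma flipProb_le_one (p : Param d) (i : Fin n) (y : Config n) : flipProb X A p i y ≤ 1 := by
  have h := abs_spin_mul_tanh (X := X) (A := A) p i y
  have := abs_le.1 (h.le.trans (Real.abs_tanh_lt_one _).le)
  rw [flipProb]; linarith

lemma field_flipAt_self (h0 : ∀ i, A i i = 0) (p : Param d) (i : Fin n) (y : Config n) :
    field X A (flipAt i y) p i = field X A y p i := by
  rw [field_flipAt, h0]; ring

lemma flipProb_flipAt_self (h0 : ∀ i, A i i = 0) (p : Param d) (i : Fin n) (y : Config n) :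
    flipProb X A p i (flipAt i y) = 1 - flipProb X A p i y := by
  rw [flipProb, flipProb, field_flipAt_self h0, spin_flipAt_self]; ring

/-- Detailed balance of the single-spin dynamics. -/
lemma law_mul_flipProb (hA : A.IsSymm) (h0 : ∀ i, A i i = 0) (p : Param d) (i : Fin n)
    (y : Config n) :
    law X A p (flipAt i y) * flipProb X A p i (flipAt i y) = law X A p y * flipProb X A p i y := by
  rw [law_flipAt hA h0, flipProb_flipAt_self h0, flipProb, Real.tanh_eq]
  set a := field X A y p i
  have e1 : Real.exp a * Real.exp (-a) = 1 := by rw [← Real.exp_add]; simp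
  rcases spin_eq_or y i with h | h <;> simp only [h]
  · have e : Real.exp (-2 * (1 * a)) = Real.exp (-a) * Real.exp (-a) := by
      rw [← Real.exp_add]; ring_nf
    rw [e]
    field_simp
    linear_combination (law X A p y * (2 * Real.exp (-a))) * e1
  · have e : Real.exp (-2 * (-1 * a)) = Real.exp a * Real.exp a := by
      rw [← Real.exp_add]; ring_nf
    rw [e]
    field_simp
    linear_combination (law X A p y * (2 * Real.exp a)) * e1

lemma sum_comp_flipAt (f : Config n → ℝ) (i : Fin n) : ∑ y, f (flipAt i y) = ∑ y, f y :=
  Equiv.sum_comp ⟨flipAt i, flipAt i, flipAt_flipAt i, flipAt_flipAt i⟩ f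

/-- A fluctuation at `i` is uncorrelated with every function of the other spins. -/
lemma expect_fluct_mul_eq_zero (hA : A.IsSymm) (h0 : ∀ i, A i i = 0) (p : Param d) (i : Fin n)
    (F φ : Config n → ℝ) (hφ : ∀ y, φ (flipAt i y) = φ y) :
    expect X A p (fun y => fluct X A p i F y * φ y) = 0 := by
  have h : expect X A p (fun y => fluct X A p i F y * φ y)
      = -expect X A p (fun y => fluct X A p i F y * φ y) := by
    conv_lhs => rw [expect, ← sum_comp_flipAt _ i]
    rw [expect, ← Finset.sum_neg_distrib]
    refine Finset.sum_congr rfl fun y _ => ?_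
    simp only [fluct, flipAt_flipAt, hφ]
    linear_combination ((F (flipAt i y) - F y) * φ y) * law_mul_flipProb hA h0 p i y
  linarith

lemma flipAt_comm {i l : Fin n} (h : i ≠ l) (y : Config n) :
    flipAt i (flipAt l y) = flipAt l (flipAt i y) := by
  simp only [flipAt, Function.update_of_ne h, Function.update_of_ne h.symm]
  exact Function.update_comm h.symm _ _ y

lemma abs_flipProb_sub_le (p : Param d) {i l : Fin n} (h : i ≠ l) (y : Config n) :
    |flipProb X A p i y - flipProb X A p i (flipAt l y)| ≤ 2 * |p.snd| * |A i l| := by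
  have hs : spin (flipAt l y) i = spin y i := by simp [flipAt, spin, h]
  have e : flipProb X A p i y - flipProb X A p i (flipAt l y)
      = -(spin y i)
        * (Real.tanh (field X A y p i) - Real.tanh (field X A (flipAt l y) p i)) / 2 := by
    rw [flipProb, flipProb, hs]; ring
  rw [e, abs_div, abs_mul, abs_neg, abs_spin, one_mul, abs_two]
  have h1 := abs_tanh_sub_le (field X A y p i) (field X A (flipAt l y) p i)
  rw [field_flipAt] at h1 ⊢
  have h2 : |field X A y p i - (field X A y p i - 4 * p.snd * A i l * spin y l)|
      = 4 * |p.snd| * |A i l| := by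
    rw [sub_sub_cancel, abs_mul, abs_mul, abs_mul, abs_spin]; simp
  linarith

section Fluct

variable {H : ℝ} {F : Config n → ℝ}

lemma abs_sub_flipAt_le (hF : ∀ y, |F y| ≤ H) (i : Fin n) (y : Config n) :
    |F y - F (flipAt i y)| ≤ 2 * H := by
  have := abs_sub (F y) (F (flipAt i y))
  linarith [hF y, hF (flipAt i y)]

lemma abs_fluct_le (hF : ∀ y, |F y| ≤ H) (p : Param d) (i : Fin n) (y : Config n) :
    |fluct X A p i F y| ≤ 2 * H := by
  rw [fluct, abs_mul, abs_of_nonneg (flipProb_nonneg p i y)]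
  have h1 := abs_sub_flipAt_le hF i y
  have h2 := flipProb_le_one (X := X) (A := A) p i y
  have h3 := flipProb_nonneg (X := X) (A := A) p i y
  nlinarith [abs_nonneg (F y - F (flipAt i y))]

lemma abs_fluct_sub_le (h0 : ∀ i, A i i = 0) (hF : ∀ y, |F y| ≤ H) {b : Fin n → ℝ}
    (hb : ∀ y l, |F y - F (flipAt l y)| ≤ b l) (p : Param d) (i l : Fin n) (y : Config n) :
    |fluct X A p i F y - fluct X A p i F (flipAt l y)| ≤ 2 * b l + 4 * |p.snd| * H * |A i l| := by
  have hH : 0 ≤ H := (abs_nonneg _).trans (hF y)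
  have hbl : 0 ≤ b l := (abs_nonneg _).trans (hb y l)
  by_cases h : i = l
  · subst h
    have e : fluct X A p i F y - fluct X A p i F (flipAt i y) = F y - F (flipAt i y) := by
      rw [fluct, fluct, flipAt_flipAt, flipProb_flipAt_self h0]; ring
    rw [e]
    have : 0 ≤ 4 * |p.snd| * H * |A i i| := by positivity
    linarith [hb y i]
  · set w := flipProb X A p i y
    set w' := flipProb X A p i (flipAt l y)
    have e : fluct X A p i F y - fluct X A p i F (flipAt l y)
        = (w - w') * (F y - F (flipAt i y)) + w' * ((F y - F (flipAt l y))
          - (F (flipAt i y) - F (flipAt l (flipAt i y)))) := by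
      rw [fluct, fluct, flipAt_comm h]; ring
    have h1 : |(w - w') * (F y - F (flipAt i y))| ≤ 2 * |p.snd| * |A i l| * (2 * H) := by
      rw [abs_mul]
      exact mul_le_mul (abs_flipProb_sub_le p h y) (abs_sub_flipAt_le hF i y) (abs_nonneg _)
        (by positivity)
    have h2 : |w' * ((F y - F (flipAt l y)) - (F (flipAt i y) - F (flipAt l (flipAt i y))))|
        ≤ 1 * (2 * b l) := by
      rw [abs_mul, abs_of_nonneg (flipProb_nonneg p i _)]
      refine mul_le_mul (flipProb_le_one p i _) ?_ (abs_nonneg _) zero_le_one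
      have := abs_sub (F y - F (flipAt l y)) (F (flipAt i y) - F (flipAt l (flipAt i y)))
      linarith [hb y l, hb (flipAt i y) l]
    rw [e]
    have := abs_add_le ((w - w') * (F y - F (flipAt i y)))
      (w' * ((F y - F (flipAt l y)) - (F (flipAt i y) - F (flipAt l (flipAt i y)))))
    nlinarith

end Fluct

/-- A sum of `n` fluctuations `hᵢ - E[hᵢ | y₋ᵢ]` has second moment `O(n)` when every spin has a
bounded total influence on the functions `hᵢ`. The correlation of the fluctuations at `i` and `l`
is at most the influence of the spin `l` on the fluctuation at `i`, because the part of the latter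
that does not depend on the spin `l` is uncorrelated with the fluctuation at `l`. -/
theorem expect_sq_sum_fluct_le (hA : A.IsSymm) (h0 : ∀ i, A i i = 0)
    (hA1 : ∀ j, ∑ i, |A i j| ≤ 1) (p : Param d) {H b : ℝ} (h : Fin n → Config n → ℝ)
    (hH : ∀ i y, |h i y| ≤ H) (hH0 : 0 ≤ H) (infl : Fin n → Fin n → ℝ)
    (hinfl : ∀ i y l, |h i y - h i (flipAt l y)| ≤ infl i l) (hb : ∀ l, ∑ i, infl i l ≤ b) :
    expect X A p (fun y => (∑ i, fluct X A p i (h i) y) ^ 2)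
      ≤ n * (H * (2 * b + 4 * |p.snd| * H)) := by
  have hcorr : ∀ l i, expect X A p (fun y => fluct X A p l (h l) y * fluct X A p i (h i) y)
      ≤ H * (2 * infl i l + 4 * |p.snd| * H * |A i l|) := by
    intro l i
    let D : Config n → ℝ := fluct X A p i (h i)
    have hz := expect_fluct_mul_eq_zero (X := X) hA h0 p l (h l)
      (fun y => (D y + D (flipAt l y)) / 2) (fun y => by simp only [flipAt_flipAt]; ring)
    have e : (fun y => fluct X A p l (h l) y * fluct X A p i (h i) y)
        = fun y => fluct X A p l (h l) y * ((D y + D (flipAt l y)) / 2)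
          + fluct X A p l (h l) y * ((D y - D (flipAt l y)) / 2) := by
      funext y; simp only [D]; ring
    rw [e, expect_add, hz, zero_add,
      ← expect_const (X := X) (A := A) p (H * (2 * infl i l + 4 * |p.snd| * H * |A i l|))]
    refine expect_mono fun y => (le_abs_self _).trans ?_
    rw [abs_mul, abs_div, abs_two]
    have h1 := abs_fluct_le (X := X) (A := A) (hH l) p l y
    have h2 := abs_fluct_sub_le (X := X) (A := A) h0 (hH i) (hinfl i) p i l y
    calc _ ≤ 2 * H * ((2 * infl i l + 4 * |p.snd| * H * |A i l|) / 2) :=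
          mul_le_mul h1 (by simp only [D]; linarith) (by positivity) (by positivity)
      _ = _ := by ring
  have e : (fun y => (∑ i, fluct X A p i (h i) y) ^ 2)
      = fun y => ∑ l, ∑ i, fluct X A p l (h l) y * fluct X A p i (h i) y := by
    funext y; rw [sq, Finset.sum_mul_sum]
  rw [e, expect_sum]
  calc _ ≤ ∑ _l : Fin n, H * (2 * b + 4 * |p.snd| * H) := by
        refine Finset.sum_le_sum fun l _ => ?_
        rw [expect_sum]
        refine (Finset.sum_le_sum fun i _ => hcorr l i).trans ?_
        rw [← Finset.mul_sum, Finset.sum_add_distrib, ← Finset.mul_sum, ← Finset.mul_sum]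
        refine mul_le_mul_of_nonneg_left ?_ hH0
        have h1 : 0 ≤ 4 * |p.snd| * H := by positivity
        nlinarith [hb l, hA1 l]
    _ = _ := by simp

/-! ### Regressing the magnetizations on the features -/

namespace Admissible

variable {M c q₁ q₂ : ℝ}

lemma abs_magnetization_le (h : Admissible M c q₁ q₂ X A) (y : Config n) (i : Fin n) :
    |(A *ᵥ spin y) i| ≤ 1 := by
  refine (abs_mulVec_spin_le A y i).trans ((Finset.sum_congr rfl fun j _ => ?_).trans_le
    (h.norm_le i))
  rw [h.symm.apply]

lemma mul_sum_sq_le (h : Admissible M c q₁ q₂ X A) (hn : 0 < n) (u : Fin d → ℝ) :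
    q₁ * n * ∑ k, u k ^ 2 ≤ ∑ i, (X *ᵥ u) i ^ 2 := by
  have hn' : (0 : ℝ) < n := by exact_mod_cast hn
  set Q : Matrix (Fin d) (Fin d) ℝ := (1 / (n : ℝ)) • (Xᵀ * X) with hQ
  have hherm : (Q - algebraMap ℝ _ q₁).IsHermitian := by
    refine Matrix.IsHermitian.sub ?_ ?_
    · rw [hQ, Matrix.IsHermitian, Matrix.conjTranspose_eq_transpose_of_trivial]
      simp
    · rw [Matrix.algebraMap_eq_diagonal]
      exact Matrix.isHermitian_diagonal _
  have hpsd : (Q - algebraMap ℝ _ q₁).PosSemidef := by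
    rw [Matrix.posSemidef_iff_isHermitian_and_spectrum_nonneg]
    refine ⟨hherm, ?_⟩
    rw [← spectrum.sub_singleton_eq]
    rintro _ ⟨a, ha, _, rfl, rfl⟩
    exact sub_nonneg.2 (h.spectrum_subset ha).1
  have h1 := hpsd.dotProduct_mulVec_nonneg u
  have e1 : star u ⬝ᵥ ((Q - algebraMap ℝ _ q₁) *ᵥ u)
      = (1 / (n : ℝ)) * ∑ i, (X *ᵥ u) i ^ 2 - q₁ * ∑ k, u k ^ 2 := by
    have e2 : u ⬝ᵥ (Xᵀ *ᵥ (X *ᵥ u)) = ∑ i, (X *ᵥ u) i ^ 2 := by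
      rw [Matrix.dotProduct_mulVec, Matrix.vecMul_transpose]
      exact Finset.sum_congr rfl fun i _ => (sq _).symm
    have e3 : u ⬝ᵥ u = ∑ k, u k ^ 2 := Finset.sum_congr rfl fun i _ => (sq _).symm
    rw [Matrix.sub_mulVec, dotProduct_sub, hQ, Matrix.smul_mulVec, dotProduct_smul,
      ← Matrix.mulVec_mulVec, Algebra.algebraMap_eq_smul_one, Matrix.smul_mulVec,
      Matrix.one_mulVec, dotProduct_smul, star_trivial, e2, e3, smul_eq_mul, smul_eq_mul]
  rw [e1] at h1
  have h2 : q₁ * ∑ k, u k ^ 2 ≤ (1 / (n : ℝ)) * ∑ i, (X *ᵥ u) i ^ 2 := by linarith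
  have h3 := mul_le_mul_of_nonneg_left h2 hn'.le
  have e4 : (n : ℝ) * ((1 / (n : ℝ)) * ∑ i, (X *ᵥ u) i ^ 2) = ∑ i, (X *ᵥ u) i ^ 2 := by
    field_simp
  linarith

/-- A vector of coefficients `u` with `XᵀX u = Xᵀ v` is small when `Xᵀ v` is. -/
lemma sum_sq_coeff_le (h : Admissible M c q₁ q₂ X A) (hn : 0 < n) (hq : 0 < q₁)
    {u : Fin d → ℝ} {t : Fin d → ℝ} (hu : Xᵀ *ᵥ (X *ᵥ u) = t) {S : ℝ} (ht : ∀ k, |t k| ≤ S) :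
    ∑ k, u k ^ 2 ≤ d * (S / (q₁ * n)) ^ 2 := by
  have hn' : (0 : ℝ) < n := by exact_mod_cast hn
  have e2 : u ⬝ᵥ (Xᵀ *ᵥ (X *ᵥ u)) = ∑ i, (X *ᵥ u) i ^ 2 := by
    rw [Matrix.dotProduct_mulVec, Matrix.vecMul_transpose]
    exact Finset.sum_congr rfl fun i _ => (sq _).symm
  have h1 := h.mul_sum_sq_le hn u
  rw [← e2, hu] at h1
  have h2 : (u ⬝ᵥ t) ^ 2 ≤ (∑ k, u k ^ 2) * ∑ k, t k ^ 2 :=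
    Finset.sum_mul_sq_le_sq_mul_sq _ _ _
  have h3 : ∑ k, t k ^ 2 ≤ d * S ^ 2 := by
    calc ∑ k, t k ^ 2 ≤ ∑ _k : Fin d, S ^ 2 :=
          Finset.sum_le_sum fun k _ => sq_le_sq' (abs_le.1 (ht k)).1 (abs_le.1 (ht k)).2
      _ = d * S ^ 2 := by simp
  set s := ∑ k, u k ^ 2
  have hs : 0 ≤ s := Finset.sum_nonneg fun k _ => sq_nonneg _
  have hqn : 0 < q₁ * n := by positivity
  rcases hs.eq_or_lt with h0 | h0
  · rw [← h0]; positivity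
  · have h4 : (q₁ * n * s) ^ 2 ≤ s * (d * S ^ 2) :=
      (pow_le_pow_left₀ (by positivity) h1 2).trans
        (h2.trans (mul_le_mul_of_nonneg_left h3 hs))
    have h5 : (q₁ * n) ^ 2 * s ≤ d * S ^ 2 := by
      refine le_of_mul_le_mul_left ?_ h0
      linarith
    rw [div_pow, ← mul_div_assoc, le_div_iff₀ (by positivity)]
    linarith

lemma abs_transpose_mulVec_le (h : Admissible M c q₁ q₂ X A) (v : Fin n → ℝ) (k : Fin d) :
    |(Xᵀ *ᵥ v) k| ≤ M * ∑ i, |v i| := by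
  rw [Finset.mul_sum]
  refine (Finset.abs_sum_le_sum_abs (fun i => Xᵀ k i * v i) Finset.univ).trans
    (Finset.sum_le_sum fun i _ => ?_)
  rw [abs_mul]
  exact mul_le_mul_of_nonneg_right (h.feature_le i k) (abs_nonneg _)

lemma sq_mulVec_le (h : Admissible M c q₁ q₂ X A) (u : Fin d → ℝ) (i : Fin n) :
    (X *ᵥ u) i ^ 2 ≤ d * M ^ 2 * ∑ k, u k ^ 2 := by
  have h2 : (X *ᵥ u) i ^ 2 ≤ (∑ k, X i k ^ 2) * ∑ k, u k ^ 2 :=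
    Finset.sum_mul_sq_le_sq_mul_sq Finset.univ (fun k => X i k) u
  have h3 : ∑ k, X i k ^ 2 ≤ d * M ^ 2 := by
    calc ∑ k, X i k ^ 2 ≤ ∑ _k : Fin d, M ^ 2 :=
          Finset.sum_le_sum fun k _ =>
            sq_le_sq' (abs_le.1 (h.feature_le i k)).1 (abs_le.1 (h.feature_le i k)).2
      _ = d * M ^ 2 := by simp
  exact h2.trans (mul_le_mul_of_nonneg_right h3 (Finset.sum_nonneg fun k _ => sq_nonneg _))

/-- The least-squares decomposition `A = G + X W`, in which the columns of `G` are orthogonal to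
those of `X`. As `X W` has rank at most `d`, its entries are `O(1 / n)`. -/
theorem exists_residual (h : Admissible M c q₁ q₂ X A) (hn : 0 < n) (hq : 0 < q₁) (hM : 0 < M) :
    ∃ (G : Matrix (Fin n) (Fin n) ℝ) (W : Matrix (Fin d) (Fin n) ℝ), A = G + X * W ∧
      Xᵀ * G = 0 ∧ (∀ i j, |A i j - G i j| ≤ d * M ^ 2 / q₁ / n) ∧
      ∀ y : Config n, ∑ k, (W *ᵥ spin y) k ^ 2 ≤ d * (M / q₁) ^ 2 := by
  have hn' : (0 : ℝ) < n := by exact_mod_cast hn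
  have hunit : IsUnit (Xᵀ * X) := by
    have h1 : IsUnit ((1 / (n : ℝ)) • (Xᵀ * X)) := by
      rw [← spectrum.zero_notMem_iff ℝ]
      exact fun h0 => absurd (h.spectrum_subset h0).1 (not_le.2 hq)
    have h2 := h1.smul (Units.mk0 (n : ℝ) hn'.ne')
    rwa [Units.smul_def, Units.val_mk0, smul_smul, mul_one_div_cancel hn'.ne', one_smul] at h2
  have hdet := (Matrix.isUnit_iff_isUnit_det _).1 hunit
  set W := (Xᵀ * X)⁻¹ * (Xᵀ * A) with hW
  have hXW : Xᵀ * (X * W) = Xᵀ * A := by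
    rw [← Matrix.mul_assoc, hW, ← Matrix.mul_assoc (Xᵀ * X), Matrix.mul_nonsing_inv _ hdet,
      Matrix.one_mul]
  refine ⟨A - X * W, W, by simp, by rw [Matrix.mul_sub, hXW, sub_self], fun i j => ?_,
    fun y => ?_⟩
  · have e : A i j - (A - X * W) i j = (X *ᵥ W.col j) i := by
      simp [Matrix.mul_apply, Matrix.mulVec, dotProduct, Matrix.col]
    have hcol : Xᵀ *ᵥ (X *ᵥ W.col j) = Xᵀ *ᵥ A.col j := by
      ext k
      have := congrFun (congrFun hXW k) j
      simp only [Matrix.mul_apply] at this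
      simpa [Matrix.mulVec, dotProduct, Matrix.col] using this
    have h1 := h.sum_sq_coeff_le hn hq hcol (S := M) fun k =>
      (h.abs_transpose_mulVec_le _ k).trans (mul_le_of_le_one_right hM.le (h.norm_le j))
    have h2 := (h.sq_mulVec_le (W.col j) i).trans
      (mul_le_mul_of_nonneg_left h1 (by positivity))
    rw [e]
    refine abs_le_of_sq_le_sq (h2.trans_eq ?_) (by positivity)
    field_simp
  · have hy : Xᵀ *ᵥ (X *ᵥ (W *ᵥ spin y)) = Xᵀ *ᵥ (A *ᵥ spin y) := by
      rw [Matrix.mulVec_mulVec, Matrix.mulVec_mulVec, Matrix.mul_assoc, hXW, Matrix.mulVec_mulVec]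
    have h1 := h.sum_sq_coeff_le hn hq hy (S := M * n) fun k =>
      (h.abs_transpose_mulVec_le _ k).trans (mul_le_mul_of_nonneg_left
        ((Finset.sum_le_sum fun i _ => h.abs_magnetization_le y i).trans_eq (by simp)) hM.le)
    rwa [mul_div_mul_right _ _ hn'.ne'] at h1

/-- If the part of the magnetizations orthogonal to the features is of order `√n`, then the
vectors `(xᵢ, 2 mᵢ)` span all directions of the parameter space equally well. -/
lemma norm_sq_le_sum_field_sq (h : Admissible M c q₁ q₂ X A) (hn : 0 < n) (hq : 0 < q₁)
    {G : Matrix (Fin n) (Fin n) ℝ} {W : Matrix (Fin d) (Fin n) ℝ} (hG : A = G + X * W)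
    (hX : Xᵀ * G = 0) {y : Config n} {w κ₀ : ℝ} (hw : ∑ k, (W *ᵥ spin y) k ^ 2 ≤ w)
    (hr : κ₀ * n ≤ ∑ i, (G *ᵥ spin y) i ^ 2) (hκ : 0 < κ₀) (v : Param d) :
    min (q₁ / 2) (4 * κ₀ / (8 * w + 1)) * n * ‖v‖ ^ 2 ≤ ∑ i, field X A y v i ^ 2 := by
  have hw0 : 0 ≤ w := (Finset.sum_nonneg fun k _ => sq_nonneg _).trans hw
  set κ := min (q₁ / 2) (4 * κ₀ / (8 * w + 1))
  have hκ1 : 2 * κ ≤ q₁ := by linarith [min_le_left (q₁ / 2) (4 * κ₀ / (8 * w + 1))]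
  have hκ2 : κ * (8 * w + 1) ≤ 4 * κ₀ := by
    rw [← le_div_iff₀ (by positivity)]; exact min_le_right _ _
  have hκ0 : 0 ≤ κ := le_min (by positivity) (by positivity)
  have hn' : (0 : ℝ) < n := by exact_mod_cast hn
  set b := v.snd
  set r := G *ᵥ spin y
  set u : Fin d → ℝ := fun k => v.fst k + 2 * b * (W *ᵥ spin y) k with hu
  have hfield : ∀ i, field X A y v i = (X *ᵥ u) i + 2 * b * r i := by
    intro i
    have e1 : A *ᵥ spin y = r + X *ᵥ (W *ᵥ spin y) := by
      rw [hG, Matrix.add_mulVec, Matrix.mulVec_mulVec]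
    have e2 : u = v.fst.ofLp + (2 * b) • (W *ᵥ spin y) := by
      ext k; simp [hu]
    rw [field_eq, e1, e2, Matrix.mulVec_add, Matrix.mulVec_smul]
    simp only [Pi.add_apply, Pi.smul_apply, smul_eq_mul]
    have e3 : ∑ k, v.fst k * X i k = (X *ᵥ v.fst.ofLp) i :=
      Finset.sum_congr rfl fun k _ => mul_comm _ _
    rw [e3]; ring
  have horth : ∑ i, (X *ᵥ u) i * r i = 0 := by
    have e : (X *ᵥ u) ⬝ᵥ r = u ⬝ᵥ (Xᵀ *ᵥ r) := by
      rw [Matrix.dotProduct_mulVec u, Matrix.vecMul_transpose]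
    have : Xᵀ *ᵥ r = 0 := by
      rw [Matrix.mulVec_mulVec, hX, Matrix.zero_mulVec]
    rw [this, dotProduct_zero] at e
    exact e
  have hsum : ∑ i, field X A y v i ^ 2 = ∑ i, (X *ᵥ u) i ^ 2 + 4 * b ^ 2 * ∑ i, r i ^ 2 := by
    have : ∀ i, field X A y v i ^ 2
        = (X *ᵥ u) i ^ 2 + 4 * b ^ 2 * r i ^ 2 + 4 * b * ((X *ᵥ u) i * r i) := by
      intro i; rw [hfield]; ring
    simp only [this, Finset.sum_add_distrib, ← Finset.mul_sum, horth]
    ring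
  have h1 := h.mul_sum_sq_le hn u
  have h2 : ∑ k, v.fst k ^ 2 ≤ 2 * ∑ k, u k ^ 2 + 8 * b ^ 2 * w := by
    calc ∑ k, v.fst k ^ 2 ≤ ∑ k, (2 * u k ^ 2 + 8 * b ^ 2 * (W *ᵥ spin y) k ^ 2) := by
          refine Finset.sum_le_sum fun k _ => ?_
          simp only [hu]
          nlinarith [sq_nonneg (v.fst k + 4 * b * (W *ᵥ spin y) k)]
      _ = 2 * ∑ k, u k ^ 2 + 8 * b ^ 2 * ∑ k, (W *ᵥ spin y) k ^ 2 := by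
          rw [Finset.sum_add_distrib, Finset.mul_sum, Finset.mul_sum]
      _ ≤ _ := by gcongr
  have hU : 0 ≤ ∑ k, u k ^ 2 := Finset.sum_nonneg fun k _ => sq_nonneg _
  rw [hsum, norm_sq_param]
  calc κ * n * (∑ k, v.fst k ^ 2 + b ^ 2)
      ≤ κ * n * ((2 * ∑ k, u k ^ 2 + 8 * b ^ 2 * w) + b ^ 2) := by gcongr
    _ = (2 * κ) * n * ∑ k, u k ^ 2 + b ^ 2 * n * (κ * (8 * w + 1)) := by ring
    _ ≤ q₁ * n * ∑ k, u k ^ 2 + b ^ 2 * n * (4 * κ₀) := by gcongr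
    _ = q₁ * n * ∑ k, u k ^ 2 + 4 * b ^ 2 * (κ₀ * n) := by ring
    _ ≤ _ := by gcongr

lemma sum_sq_le_one (h : Admissible M c q₁ q₂ X A) (j : Fin n) : ∑ i, A i j ^ 2 ≤ 1 := by
  have h1 : ∀ i, |A i j| ≤ 1 := fun i =>
    (Finset.single_le_sum (fun i _ => abs_nonneg (A i j)) (Finset.mem_univ i)).trans (h.norm_le j)
  refine (Finset.sum_le_sum fun i _ => ?_).trans (h.norm_le j)
  rw [← sq_abs]
  nlinarith [h1 i, abs_nonneg (A i j)]

/-- A matrix with bounded row sums and with `‖A‖_F² ≥ c n` has many entries of constant order. -/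
lemma le_sum_pow_four (h : Admissible M c q₁ q₂ X A) (hc : 0 < c) :
    c ^ 3 / 8 * n ≤ ∑ j, ∑ i, A i j ^ 4 := by
  have hpt : ∀ t : ℝ, c ^ 2 / 4 * (t ^ 2 - c / 2 * |t|) ≤ t ^ 4 := by
    intro t
    rw [← sq_abs t, ← Even.pow_abs (n := 4) (by decide)]
    generalize |t| = s, abs_nonneg t = hs
    -- `t² ≤ (c/2) |t|` if `|t| ≤ c/2`, and `t² (c/2)² ≤ t⁴` otherwise
    rcases le_total s (c / 2) with hsc | hsc
    · have : s ^ 2 - c / 2 * s ≤ 0 := by nlinarith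
      have h4 : 0 ≤ s ^ 4 := by positivity
      nlinarith [sq_nonneg c]
    · have : c ^ 2 / 4 ≤ s ^ 2 := by nlinarith
      have h5 : c ^ 2 / 4 * s ^ 2 ≤ s ^ 2 * s ^ 2 := by gcongr
      have h6 : 0 ≤ c ^ 2 / 4 * (c / 2 * s) := by positivity
      nlinarith
  have hsum : ∑ j, ∑ i, c ^ 2 / 4 * (A i j ^ 2 - c / 2 * |A i j|) ≤ ∑ j, ∑ i, A i j ^ 4 :=
    Finset.sum_le_sum fun j _ => Finset.sum_le_sum fun i _ => hpt _
  refine le_trans ?_ hsum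
  simp only [← Finset.mul_sum, Finset.sum_sub_distrib]
  have h1 : ∑ j, ∑ i, |A i j| ≤ n :=
    (Finset.sum_le_sum fun j _ => h.norm_le j).trans_eq (by simp)
  have h2 := h.frobenius_ge
  rw [Finset.sum_comm] at h2
  have h3 : c / 2 * ∑ j, ∑ i, |A i j| ≤ c / 2 * n := by gcongr
  have h4 : c / 2 * n ≤ ∑ j, ∑ i, A i j ^ 2 - c / 2 * ∑ j, ∑ i, |A i j| := by linarith
  calc c ^ 3 / 8 * n = c ^ 2 / 4 * (c / 2 * n) := by ring
    _ ≤ _ := by gcongr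

lemma le_sum_sq_mul_sq (h : Admissible M c q₁ q₂ X A) (hc : 0 < c) (hn : 0 < n)
    {G : Matrix (Fin n) (Fin n) ℝ} {K : ℝ} (hG : ∀ i j, |A i j - G i j| ≤ K / n) :
    c ^ 3 / 16 * n - K ^ 2 / n ≤ ∑ j, ∑ i, A i j ^ 2 * G i j ^ 2 := by
  have hn' : (0 : ℝ) < n := by exact_mod_cast hn
  have hpt : ∀ i j, 1 / 2 * A i j ^ 4 - (K / n) ^ 2 * A i j ^ 2 ≤ A i j ^ 2 * G i j ^ 2 := by
    intro i j
    have h1 : (A i j - G i j) ^ 2 ≤ (K / n) ^ 2 :=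
      sq_le_sq' (abs_le.1 (hG i j)).1 (abs_le.1 (hG i j)).2
    have h2 : 1 / 2 * A i j ^ 2 - (K / n) ^ 2 ≤ G i j ^ 2 := by
      nlinarith [sq_nonneg (A i j - 2 * G i j)]
    calc _ = A i j ^ 2 * (1 / 2 * A i j ^ 2 - (K / n) ^ 2) := by ring
      _ ≤ _ := by gcongr
  refine le_trans ?_ (Finset.sum_le_sum fun j _ => Finset.sum_le_sum fun i _ => hpt i j)
  simp only [Finset.sum_sub_distrib, ← Finset.mul_sum]
  have h1 := h.le_sum_pow_four hc
  have h2 : ∑ j, ∑ i, A i j ^ 2 ≤ n :=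
    (Finset.sum_le_sum fun j _ => h.sum_sq_le_one j).trans_eq (by simp)
  have h3 : (K / n) ^ 2 * ∑ j, ∑ i, A i j ^ 2 ≤ (K / n) ^ 2 * n := by gcongr
  have h4 : (K / n) ^ 2 * n = K ^ 2 / n := by field_simp
  linarith

end Admissible

variable {M c q₁ q₂ : ℝ}

/-! ### Second moment of the gradient at the true parameter -/

lemma fluct_mul_spin {u : Config n → ℝ} {i : Fin n} (hu : ∀ y, u (flipAt i y) = u y)
    (p : Param d) (y : Config n) :
    fluct X A p i (fun y => u y * spin y i) y
      = u y * (spin y i - Real.tanh (field X A y p i)) := by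
  simp only [fluct, flipProb, hu, spin_flipAt_self]
  linear_combination (-(u y * Real.tanh (field X A y p i))) * spin_sq y i

/-- At the true parameter `n ‖∇(-LPL)‖²` has bounded expectation, because each coordinate of
`n ∇LPL` is a sum of fluctuations. -/
lemma Admissible.expect_norm_sq_grad_le (h : Admissible M c q₁ q₂ X A) (hn : 0 < n) (hM : 0 < M)
    (p : Param d) :
    expect X A p (fun y => n * ‖grad X A y p‖ ^ 2)
      ≤ d * (M * (2 * (2 * M) + 4 * |p.snd| * M)) + 2 * (2 * 8 + 4 * |p.snd| * 2) := by
  have hn' : (0 : ℝ) < n := by exact_mod_cast hn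
  have hfst : ∀ k y, n * (grad X A y p).fst k
      = -∑ i, fluct X A p i (fun y => X i k * spin y i) y := by
    intro k y
    rw [grad_fst h.symm h.diag_zero, Finset.mul_sum, ← Finset.sum_neg_distrib]
    refine Finset.sum_congr rfl fun i _ => ?_
    rw [fluct_mul_spin (u := fun _ => X i k) fun _ => rfl]
    field_simp
    ring
  have hsnd : ∀ y, n * (grad X A y p).snd
      = -∑ i, fluct X A p i (fun y => 2 * (A *ᵥ spin y) i * spin y i) y := by
    intro y
    rw [grad_snd h.symm h.diag_zero, Finset.mul_sum, ← Finset.sum_neg_distrib]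
    refine Finset.sum_congr rfl fun i _ => ?_
    rw [fluct_mul_spin (u := fun y => 2 * (A *ᵥ spin y) i)
      fun y => by rw [mulVec_spin_flipAt, h.diag_zero]; ring]
    field_simp
    ring
  have e : (fun y => n * ‖grad X A y p‖ ^ 2) = fun y => (1 / (n : ℝ)) *
      (∑ k, (∑ i, fluct X A p i (fun y => X i k * spin y i) y) ^ 2
        + (∑ i, fluct X A p i (fun y => 2 * (A *ᵥ spin y) i * spin y i) y) ^ 2) := by
    funext y
    have e1 : ∑ k, (∑ i, fluct X A p i (fun y => X i k * spin y i) y) ^ 2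
        = n ^ 2 * ∑ k, (grad X A y p).fst k ^ 2 := by
      rw [Finset.mul_sum]
      exact Finset.sum_congr rfl fun k _ => by rw [← mul_pow, hfst, neg_sq]
    have e2 : (∑ i, fluct X A p i (fun y => 2 * (A *ᵥ spin y) i * spin y i) y) ^ 2
        = n ^ 2 * (grad X A y p).snd ^ 2 := by
      rw [← mul_pow, hsnd, neg_sq]
    rw [e1, e2, norm_sq_param]
    field_simp
  have h1 : ∀ k, expect X A p (fun y => (∑ i, fluct X A p i (fun y => X i k * spin y i) y) ^ 2)
      ≤ n * (M * (2 * (2 * M) + 4 * |p.snd| * M)) := by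
    intro k
    refine expect_sq_sum_fluct_le h.symm h.diag_zero h.norm_le p _ (fun i y => ?_) hM.le
      (fun i l => if i = l then 2 * M else 0) (fun i y l => ?_) (fun l => by simp)
    · rw [abs_mul, abs_spin, mul_one]; exact h.feature_le i k
    · split_ifs with hil
      · subst hil
        rw [spin_flipAt_self]
        have : X i k * spin y i - X i k * -spin y i = 2 * (X i k * spin y i) := by ring
        rw [this, abs_mul, abs_mul, abs_spin, abs_two, mul_one]
        linarith [h.feature_le i k]
      · have : spin (flipAt l y) i = spin y i := by simp [flipAt, spin, hil]
        rw [this]; simp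
  have h2 : expect X A p
      (fun y => (∑ i, fluct X A p i (fun y => 2 * (A *ᵥ spin y) i * spin y i) y) ^ 2)
      ≤ n * (2 * (2 * 8 + 4 * |p.snd| * 2)) := by
    have hbd : ∀ (i : Fin n) (y : Config n), |2 * (A *ᵥ spin y) i * spin y i| ≤ 2 := by
      intro i y
      rw [abs_mul, abs_spin, abs_mul, abs_two]
      linarith [h.abs_magnetization_le y i]
    refine expect_sq_sum_fluct_le h.symm h.diag_zero h.norm_le p _ hbd zero_le_two
      (fun i l => (if i = l then 4 else 0) + 4 * |A i l|) (fun i y l => ?_) (fun l => ?_)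
    · split_ifs with hil
      · refine (abs_sub _ _).trans ?_
        linarith [hbd i y, hbd i (flipAt l y), abs_nonneg (A i l)]
      · have : spin (flipAt l y) i = spin y i := by simp [flipAt, spin, hil]
        rw [this, mulVec_spin_flipAt]
        have e : 2 * (A *ᵥ spin y) i * spin y i
            - 2 * ((A *ᵥ spin y) i - 2 * A i l * spin y l) * spin y i
            = 4 * A i l * spin y l * spin y i := by ring
        rw [e, abs_mul, abs_mul, abs_mul, abs_spin, abs_spin]
        simp
    · rw [Finset.sum_add_distrib, ← Finset.mul_sum]
      have := h.norm_le l
      simp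
      linarith
  rw [e, expect_const_mul, expect_add, expect_sum]
  have h3 : ∑ k, expect X A p
      (fun y => (∑ i, fluct X A p i (fun y => X i k * spin y i) y) ^ 2)
      ≤ ∑ _k : Fin d, n * (M * (2 * (2 * M) + 4 * |p.snd| * M)) :=
    Finset.sum_le_sum fun k _ => h1 k
  rw [Finset.sum_const, Finset.card_univ, Fintype.card_fin, nsmul_eq_mul] at h3
  rw [one_div, inv_mul_le_iff₀ hn']
  linarith

/-! ### The magnetizations are not explained by the features -/

/-- `∑ᵢ Aᵢⱼ² rᵢ²` for the residual magnetizations `r = G y`: the part of the squared residual that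
is attributed to the spin `j`. -/
def residualShare (A G : Matrix (Fin n) (Fin n) ℝ) (j : Fin n) (y : Config n) : ℝ :=
  ∑ i, A i j ^ 2 * (G *ᵥ spin y) i ^ 2

lemma Admissible.sum_row_sq_le_one (h : Admissible M c q₁ q₂ X A) (i : Fin n) :
    ∑ j, A i j ^ 2 ≤ 1 := by
  refine (Finset.sum_congr rfl fun j _ => ?_).trans_le (h.sum_sq_le_one i)
  rw [h.symm.apply]

lemma Admissible.sum_residualShare_le (h : Admissible M c q₁ q₂ X A)
    (G : Matrix (Fin n) (Fin n) ℝ) (y : Config n) :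
    ∑ j, residualShare A G j y ≤ ∑ i, (G *ᵥ spin y) i ^ 2 := by
  simp only [residualShare]
  rw [Finset.sum_comm]
  refine Finset.sum_le_sum fun i _ => ?_
  rw [← Finset.sum_mul]
  exact mul_le_of_le_one_left (sq_nonneg _) (h.sum_row_sq_le_one i)

lemma Admissible.expect_sq_sum_fluct_residualShare_le (h : Admissible M c q₁ q₂ X A)
    {G : Matrix (Fin n) (Fin n) ℝ} {L : ℝ} (hrow : ∀ i, ∑ j, |G i j| ≤ L)
    (hcol : ∀ j, ∑ i, |G i j| ≤ L) (p : Param d) (hL : 0 ≤ L) :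
    expect X A p (fun y => (∑ j, fluct X A p j (residualShare A G j) y) ^ 2)
      ≤ n * (L ^ 2 * (2 * (4 * L ^ 2) + 4 * |p.snd| * L ^ 2)) := by
  have hr : ∀ y i, |(G *ᵥ spin y) i| ≤ L := fun y i => (abs_mulVec_spin_le G y i).trans (hrow i)
  refine expect_sq_sum_fluct_le h.symm h.diag_zero h.norm_le p _ (fun j y => ?_) (sq_nonneg L)
    (fun j l => ∑ i, A i j ^ 2 * (4 * L * |G i l|)) (fun j y l => ?_) (fun l => ?_)
  · rw [residualShare, abs_of_nonneg (Finset.sum_nonneg fun i _ => by positivity)]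
    calc _ ≤ ∑ i, A i j ^ 2 * L ^ 2 := Finset.sum_le_sum fun i _ =>
          mul_le_mul_of_nonneg_left
            (sq_le_sq' (abs_le.1 (hr y i)).1 (abs_le.1 (hr y i)).2) (sq_nonneg _)
      _ = (∑ i, A i j ^ 2) * L ^ 2 := by rw [Finset.sum_mul]
      _ ≤ L ^ 2 := mul_le_of_le_one_left (sq_nonneg _) (h.sum_sq_le_one j)
  · rw [residualShare, residualShare, ← Finset.sum_sub_distrib]
    refine (Finset.abs_sum_le_sum_abs _ _).trans (Finset.sum_le_sum fun i _ => ?_)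
    rw [← mul_sub, abs_mul, abs_of_nonneg (sq_nonneg (A i j))]
    refine mul_le_mul_of_nonneg_left ?_ (sq_nonneg _)
    rw [sq_sub_sq, abs_mul]
    have h1 : |(G *ᵥ spin y) i + (G *ᵥ spin (flipAt l y)) i| ≤ 2 * L :=
      (abs_add_le _ _).trans (by linarith [hr y i, hr (flipAt l y) i])
    have h2 : |(G *ᵥ spin y) i - (G *ᵥ spin (flipAt l y)) i| = 2 * |G i l| := by
      rw [mulVec_spin_flipAt, sub_sub_cancel, abs_mul, abs_mul, abs_spin]; simp
    rw [h2]
    nlinarith [abs_nonneg (G i l)]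
  · rw [Finset.sum_comm]
    calc ∑ i, ∑ j, A i j ^ 2 * (4 * L * |G i l|) ≤ ∑ i, 4 * L * |G i l| := by
          refine Finset.sum_le_sum fun i _ => ?_
          rw [← Finset.sum_mul]
          exact mul_le_of_le_one_left (by positivity) (h.sum_row_sq_le_one i)
      _ ≤ 4 * L * L := by
          rw [← Finset.mul_sum]; exact mul_le_mul_of_nonneg_left (hcol l) (by positivity)
      _ = 4 * L ^ 2 := by ring

/-- Given the other spins, the spin `j` moves `rᵢ` by `2 Gᵢⱼ`, and both its values have conditional
probability at least `(1 - tanh R) / 2`; so the conditional mean of `rᵢ²` is at least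
`(1 - tanh R) Gᵢⱼ²`. -/
lemma le_sub_fluct_residualShare {R : ℝ} {p : Param d} {y : Config n} {j : Fin n}
    (hR : |field X A y p j| ≤ R) (G : Matrix (Fin n) (Fin n) ℝ) :
    (1 - Real.tanh R) * ∑ i, A i j ^ 2 * G i j ^ 2
      ≤ residualShare A G j y - fluct X A p j (residualShare A G j) y := by
  have hw := abs_le.1 ((abs_spin_mul_tanh (X := X) (A := A) p j y).le.trans (abs_tanh_le hR))
  have hR1 := Real.tanh_lt_one R
  set w := flipProb X A p j y with hw_def
  have hw1 : (1 - Real.tanh R) / 2 ≤ w := by rw [hw_def, flipProb]; linarith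
  have hw2 : (1 - Real.tanh R) / 2 ≤ 1 - w := by rw [hw_def, flipProb]; linarith
  have e : residualShare A G j y - fluct X A p j (residualShare A G j) y
      = ∑ i, A i j ^ 2 * ((1 - w) * (G *ᵥ spin y) i ^ 2
        + w * (G *ᵥ spin (flipAt j y)) i ^ 2) := by
    have : residualShare A G j y - fluct X A p j (residualShare A G j) y
        = (1 - w) * residualShare A G j y + w * residualShare A G j (flipAt j y) := by
      rw [fluct]; ring
    rw [this, residualShare, residualShare, Finset.mul_sum, Finset.mul_sum,
      ← Finset.sum_add_distrib]
    exact Finset.sum_congr rfl fun i _ => by ring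
  rw [e, Finset.mul_sum]
  refine Finset.sum_le_sum fun i _ => ?_
  rw [mul_left_comm]
  refine mul_le_mul_of_nonneg_left ?_ (sq_nonneg _)
  rw [mulVec_spin_flipAt]
  set r := (G *ᵥ spin y) i
  have hs : (G i j * spin y j) ^ 2 = G i j ^ 2 := by rw [mul_pow, spin_sq, mul_one]
  have h1 : (1 - Real.tanh R) / 2 * r ^ 2 ≤ (1 - w) * r ^ 2 := by gcongr
  have h2 : (1 - Real.tanh R) / 2 * (r - 2 * G i j * spin y j) ^ 2
      ≤ w * (r - 2 * G i j * spin y j) ^ 2 := by gcongr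
  have h3 : 2 * G i j ^ 2 ≤ r ^ 2 + (r - 2 * G i j * spin y j) ^ 2 := by
    rw [← hs]; nlinarith [sq_nonneg (r - G i j * spin y j)]
  have h4 : (1 - Real.tanh R) / 2 * (2 * G i j ^ 2)
      ≤ (1 - Real.tanh R) / 2 * (r ^ 2 + (r - 2 * G i j * spin y j) ^ 2) := by
    refine mul_le_mul_of_nonneg_left h3 (by linarith)
  linarith

/-- The parameter `p` lies in the closed box `[-T, T]ᵈ × [-b, b]`. -/
def InBox (T b : ℝ) (p : Param d) : Prop := (∀ k, |p.fst k| ≤ T) ∧ |p.snd| ≤ b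

lemma Admissible.abs_field_le (h : Admissible M c q₁ q₂ X A) {T b : ℝ}
    {p : Param d} (hp : InBox T b p) (y : Config n) (i : Fin n) :
    |field X A y p i| ≤ d * (T * M) + 2 * b := by
  rw [field_eq]
  refine (abs_add_le _ _).trans (add_le_add ?_ ?_)
  · refine (Finset.abs_sum_le_sum_abs _ _).trans ?_
    calc ∑ k, |p.fst k * X i k| ≤ ∑ _k : Fin d, T * M := by
          refine Finset.sum_le_sum fun k _ => ?_
          rw [abs_mul]
          exact mul_le_mul (hp.1 k) (h.feature_le i k) (abs_nonneg _)
            ((abs_nonneg _).trans (hp.1 k))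
      _ = d * (T * M) := by simp
  · rw [abs_mul, abs_mul, abs_two]
    have := h.abs_magnetization_le y i
    have := hp.2
    nlinarith [abs_nonneg p.snd, abs_nonneg ((A *ᵥ spin y) i)]

lemma Admissible.sum_sq_residual_ge (h : Admissible M c q₁ q₂ X A) (hc : 0 < c)
    (hn : 0 < n) {T b : ℝ} {p : Param d} (hp : InBox T b p)
    {G : Matrix (Fin n) (Fin n) ℝ} {K : ℝ} (hG : ∀ i j, |A i j - G i j| ≤ K / n)
    (hK : 64 * K ^ 2 ≤ c ^ 3 * n) (y : Config n)
    (hT : (∑ j, fluct X A p j (residualShare A G j) y) ^ 2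
      ≤ ((1 - Real.tanh (d * (T * M) + 2 * b)) * (c ^ 3 / 64) * n) ^ 2) :
    (1 - Real.tanh (d * (T * M) + 2 * b)) * (c ^ 3 / 32) * n ≤ ∑ i, (G *ᵥ spin y) i ^ 2 := by
  have hn' : (0 : ℝ) < n := by exact_mod_cast hn
  set R := d * (T * M) + 2 * b
  have hR1 : 0 < 1 - Real.tanh R := by linarith [Real.tanh_lt_one R]
  have h1 : (1 - Real.tanh R) * ∑ j, ∑ i, A i j ^ 2 * G i j ^ 2
      ≤ ∑ j, residualShare A G j y - ∑ j, fluct X A p j (residualShare A G j) y := by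
    rw [← Finset.sum_sub_distrib, Finset.mul_sum]
    exact Finset.sum_le_sum fun j _ =>
      le_sub_fluct_residualShare (h.abs_field_le hp y j) G
  have h2 := (abs_le.1 (abs_le_of_sq_le_sq hT (by positivity))).1
  have h3 := h.sum_residualShare_le G y
  have h4 := mul_le_mul_of_nonneg_left (h.le_sum_sq_mul_sq hc hn hG) hR1.le
  have h5 : K ^ 2 / n ≤ c ^ 3 / 64 * n := by
    rw [div_le_iff₀ hn']
    have : (1 : ℝ) ≤ n := by exact_mod_cast hn
    nlinarith [sq_nonneg K, pow_pos hc 3]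
  have h6 : (1 - Real.tanh R) * (c ^ 3 / 16 * n - c ^ 3 / 64 * n)
      ≤ (1 - Real.tanh R) * (c ^ 3 / 16 * n - K ^ 2 / n) := by gcongr
  linarith

lemma InOpenBox.inBox {Θ B : ℝ} {p : Param d} (h : InOpenBox Θ B p) : InBox Θ B p :=
  ⟨fun k => (abs_lt.2 (h.1 k)).le, (abs_lt.2 h.2).le⟩

/-- With probability at least `1 - δ` the gradient at the true parameter is `O(1 / √n)` and the
vectors `(xᵢ, 2 mᵢ)` span all directions. -/
theorem exists_good_event (d : ℕ) {Θ B M c q₁ q₂ δ : ℝ} (hB : 0 < B) (hM : 0 < M)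
    (hc : 0 < c) (hq₁ : 0 < q₁) (hδ : 0 < δ) :
    ∃ g κ : ℝ, 0 < g ∧ 0 < κ ∧ ∃ n₀ : ℕ, ∀ n : ℕ, n₀ ≤ n →
      ∀ (X : Matrix (Fin n) (Fin d) ℝ) (A : Matrix (Fin n) (Fin n) ℝ),
        Admissible M c q₁ q₂ X A → ∀ p₀ : Param d, InOpenBox Θ B p₀ →
        ∀ E : Set (Config n), (∀ y, ‖grad X A y p₀‖ ≤ g / √(n : ℝ) →
          (∀ v : Param d, κ * n * ‖v‖ ^ 2 ≤ ∑ i, field X A y v i ^ 2) → y ∈ E) →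
        1 - δ ≤ prob X A p₀ E := by
  set K := d * M ^ 2 / q₁ with hK
  have hK0 : 0 ≤ K := by positivity
  set L := 1 + K
  set R := d * (Θ * M) + 2 * B
  set ε := (1 - Real.tanh R) * (c ^ 3 / 64)
  have hR1 : 0 < 1 - Real.tanh R := by linarith [Real.tanh_lt_one R]
  have hε : 0 < ε := by positivity
  set Cg := d * (M * (2 * (2 * M) + 4 * B * M)) + 2 * (2 * 8 + 4 * B * 2)
  have hCg : 0 < Cg := by positivity
  set CT := L ^ 2 * (2 * (4 * L ^ 2) + 4 * B * L ^ 2)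
  have hCT : 0 < CT := by positivity
  -- `2 ε` is the constant `κ₀` in `‖r‖² ≥ κ₀ n`, and `g` comes from Markov's inequality
  refine ⟨√(2 * Cg / δ), min (q₁ / 2) (4 * (2 * ε) / (8 * (d * (M / q₁) ^ 2) + 1)),
    by positivity, lt_min (by positivity) (by positivity),
    max 1 (max ⌈64 * K ^ 2 / c ^ 3⌉₊ ⌈2 * CT / (ε ^ 2 * δ)⌉₊), ?_⟩
  intro n hn₀ X A h p₀ hp₀ E hE
  have hn : 0 < n := lt_of_lt_of_le one_pos ((le_max_left _ _).trans hn₀)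
  have hn' : (0 : ℝ) < n := by exact_mod_cast hn
  have hn1 : 64 * K ^ 2 / c ^ 3 ≤ n := (Nat.le_ceil _).trans
    (by exact_mod_cast ((le_max_left _ _).trans (le_max_right _ _)).trans hn₀)
  have hn2 : 2 * CT / (ε ^ 2 * δ) ≤ n := (Nat.le_ceil _).trans
    (by exact_mod_cast ((le_max_right _ _).trans (le_max_right _ _)).trans hn₀)
  have hβ : |p₀.snd| ≤ B := hp₀.inBox.2
  obtain ⟨G, W, hGW, hXG, hGA, hW⟩ := h.exists_residual hn hq₁ hM
  have hsub : ∀ i j, |G i j| ≤ |A i j| + K / n := fun i j => by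
    have := abs_sub_abs_le_abs_sub (G i j) (A i j)
    rw [abs_sub_comm] at this
    linarith [hGA i j]
  have hcol : ∀ j, ∑ i, |G i j| ≤ L := fun j => by
    refine (Finset.sum_le_sum fun i _ => hsub i j).trans ?_
    rw [Finset.sum_add_distrib]
    have e : ∑ _i : Fin n, K / n = K := by simp; field_simp
    rw [e]
    linarith [h.norm_le j]
  have hrow : ∀ i, ∑ j, |G i j| ≤ L := fun i => by
    refine (Finset.sum_le_sum fun j _ => hsub i j).trans ?_
    rw [Finset.sum_add_distrib]
    have e : ∑ _i : Fin n, K / n = K := by simp; field_simp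
    have e1 : ∑ j, |A i j| = ∑ j, |A j i| := Finset.sum_congr rfl fun j _ => by rw [h.symm.apply]
    rw [e, e1]
    linarith [h.norm_le i]
  let Tsum : Config n → ℝ := fun y => ∑ j, fluct X A p₀ j (residualShare A G j) y
  have hE1 : expect X A p₀ (fun y => n * ‖grad X A y p₀‖ ^ 2) ≤ Cg :=
    (h.expect_norm_sq_grad_le hn hM p₀).trans (by simp only [Cg]; gcongr)
  have hE2 : expect X A p₀ (fun y => Tsum y ^ 2) ≤ n * CT :=
    (h.expect_sq_sum_fluct_residualShare_le hrow hcol p₀ (by positivity)).trans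
      (by simp only [CT]; gcongr)
  -- each of the two bad events has probability at most `δ / 2`
  let V : Config n → ℝ := fun y => δ / (2 * Cg) * (n * ‖grad X A y p₀‖ ^ 2)
    + 1 / (ε * n) ^ 2 * Tsum y ^ 2
  have hV : expect X A p₀ V ≤ δ := by
    have e : expect X A p₀ V = δ / (2 * Cg) * expect X A p₀ (fun y => n * ‖grad X A y p₀‖ ^ 2)
        + 1 / (ε * n) ^ 2 * expect X A p₀ (fun y => Tsum y ^ 2) := by
      simp only [V]
      rw [expect_add, expect_const_mul _ (δ / (2 * Cg)), expect_const_mul _ (1 / (ε * n) ^ 2)]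
    rw [e]
    have h1 : δ / (2 * Cg) * expect X A p₀ (fun y => n * ‖grad X A y p₀‖ ^ 2)
        ≤ δ / (2 * Cg) * Cg := by gcongr
    have h2 : 1 / (ε * n) ^ 2 * expect X A p₀ (fun y => Tsum y ^ 2)
        ≤ 1 / (ε * n) ^ 2 * (n * CT) := by gcongr
    have h3 : δ / (2 * Cg) * Cg = δ / 2 := by field_simp
    have h4 : 1 / (ε * n) ^ 2 * (n * CT) ≤ δ / 2 := by
      rw [div_le_iff₀ (by positivity)] at hn2
      rw [one_div, inv_mul_le_iff₀ (by positivity)]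
      nlinarith
    linarith
  refine le_trans (by linarith) (one_sub_expect_le_prob (V := V)
    (fun y => by positivity) fun y hy => ?_)
  by_contra hlt
  push Not at hlt
  refine hy (hE y ?_ fun v => ?_)
  · have h1 : δ / (2 * Cg) * (n * ‖grad X A y p₀‖ ^ 2) ≤ 1 := by
      have : 0 ≤ 1 / (ε * n) ^ 2 * Tsum y ^ 2 := by positivity
      simp only [V] at hlt
      linarith
    rw [← Real.sqrt_div (by positivity)]
    refine Real.le_sqrt_of_sq_le ?_
    rw [le_div_iff₀ hn', le_div_iff₀ hδ]
    rw [div_mul_eq_mul_div, div_le_one (by positivity)] at h1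
    linarith
  · have h1 : 1 / (ε * n) ^ 2 * Tsum y ^ 2 ≤ 1 := by
      have : 0 ≤ δ / (2 * Cg) * (n * ‖grad X A y p₀‖ ^ 2) := by positivity
      simp only [V] at hlt
      linarith
    rw [one_div, inv_mul_le_iff₀ (by positivity), mul_one] at h1
    have hK' : 64 * K ^ 2 ≤ c ^ 3 * n := by
      rw [div_le_iff₀ (by positivity)] at hn1; linarith
    have h2 := h.sum_sq_residual_ge hc hn hp₀.inBox hGA hK' y h1
    have h3 : 2 * ε * n ≤ ∑ i, (G *ᵥ spin y) i ^ 2 :=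
      le_trans (le_of_eq (by simp only [ε, R]; ring)) h2
    exact h.norm_sq_le_sum_field_sq hn hq₁ hGW hXG (hW y) h3 (by positivity) v

/-! ### Convexity and smoothness of the negative log-pseudo-likelihood -/

lemma field_sub (y : Config n) (p q : Param d) (i : Fin n) :
    field X A y (p - q) i = field X A y p i - field X A y q i :=
  inner_sub_right _ _ _

lemma inner_grad (hA : A.IsSymm) (h0 : ∀ i, A i i = 0) (y : Config n) (p v : Param d) :
    inner ℝ (grad X A y p) v
      = (1 / (n : ℝ)) * ∑ i, (Real.tanh (field X A y p i) - spin y i) * field X A y v i := by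
  rw [grad_eq hA h0, real_inner_smul_left, sum_inner]
  simp only [real_inner_smul_left, field]

lemma inner_grad_sub_grad (hA : A.IsSymm) (h0 : ∀ i, A i i = 0) (y : Config n) (p q : Param d) :
    inner ℝ (grad X A y p - grad X A y q) (p - q)
      = (1 / (n : ℝ)) * ∑ i, (Real.tanh (field X A y p i) - Real.tanh (field X A y q i))
        * (field X A y p i - field X A y q i) := by
  rw [inner_sub_left, inner_grad hA h0, inner_grad hA h0, ← mul_sub, ← Finset.sum_sub_distrib]
  congr 1
  exact Finset.sum_congr rfl fun i _ => by rw [field_sub]; ring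

/-- The first-order lower bound for the objective, with the quadratic term that strong convexity of
`log (2 cosh)` on the range `[-R, R]` of the local fields provides. -/
lemma neg_LPL_ge (hA : A.IsSymm) (h0 : ∀ i, A i i = 0) {y : Config n} {p q : Param d} {R : ℝ}
    (hp : ∀ i, |field X A y p i| ≤ R) (hq : ∀ i, |field X A y q i| ≤ R) :
    -LPL X A y p + inner ℝ (grad X A y p) (q - p)
      + (1 - Real.tanh R ^ 2) / 2 * ((1 / (n : ℝ)) * ∑ i, field X A y (q - p) i ^ 2)
      ≤ -LPL X A y q := by
  rw [inner_grad hA h0, neg_LPL_eq hA h0, neg_LPL_eq hA h0, ← mul_add, mul_left_comm, ← mul_add,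
    ← Finset.sum_add_distrib, Finset.mul_sum, ← Finset.sum_add_distrib]
  refine mul_le_mul_of_nonneg_left (Finset.sum_le_sum fun i _ => ?_) (by positivity)
  rw [field_sub]
  linarith [log_two_cosh_ge (hp i) (hq i)]

lemma neg_LPL_convex (hA : A.IsSymm) (h0 : ∀ i, A i i = 0) (y : Config n) (p q : Param d) :
    -LPL X A y p + inner ℝ (grad X A y p) (q - p) ≤ -LPL X A y q := by
  set R := ∑ i, |field X A y p i| + ∑ i, |field X A y q i|
  have hle : ∀ (f : Fin n → ℝ) i, |f i| ≤ ∑ i, |f i| := fun f i =>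
    Finset.single_le_sum (f := fun i => |f i|) (fun i _ => abs_nonneg _) (Finset.mem_univ i)
  have hnn : ∀ f : Fin n → ℝ, 0 ≤ ∑ i, |f i| := fun f => Finset.sum_nonneg fun i _ => abs_nonneg _
  have h := neg_LPL_ge (X := X) (R := R) hA h0 (y := y) (p := p) (q := q)
    (fun i => (hle (field X A y p) i).trans (le_add_of_nonneg_right (hnn _)))
    (fun i => (hle (field X A y q) i).trans (le_add_of_nonneg_left (hnn _)))
  have : 0 ≤ (1 - Real.tanh R ^ 2) / 2 * ((1 / (n : ℝ)) * ∑ i, field X A y (q - p) i ^ 2) :=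
    mul_nonneg (by linarith [one_sub_tanh_sq_pos R])
      (mul_nonneg (by positivity) (Finset.sum_nonneg fun i _ => sq_nonneg _))
  linarith

lemma strongMono_grad (hA : A.IsSymm) (h0 : ∀ i, A i i = 0) (hn : 0 < n) {y : Config n}
    {p q : Param d} {R κ : ℝ} (hp : ∀ i, |field X A y p i| ≤ R) (hq : ∀ i, |field X A y q i| ≤ R)
    (hκ : ∀ v : Param d, κ * n * ‖v‖ ^ 2 ≤ ∑ i, field X A y v i ^ 2) :
    (1 - Real.tanh R ^ 2) * κ * ‖p - q‖ ^ 2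
      ≤ inner ℝ (grad X A y p - grad X A y q) (p - q) := by
  have hn' : (0 : ℝ) < n := by exact_mod_cast hn
  rw [inner_grad_sub_grad hA h0, one_div, ← div_eq_inv_mul, le_div_iff₀ hn']
  have h1 := mul_le_mul_of_nonneg_left (hκ (p - q)) (one_sub_tanh_sq_pos R).le
  rw [Finset.mul_sum] at h1
  calc _ = (1 - Real.tanh R ^ 2) * (κ * n * ‖p - q‖ ^ 2) := by ring
    _ ≤ _ := h1
    _ ≤ _ := Finset.sum_le_sum fun i _ => by
      rw [field_sub]; exact tanh_sub_mul_sub_ge (hp i) (hq i)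

lemma Admissible.norm_feature_sq_le (h : Admissible M c q₁ q₂ X A) (y : Config n) (i : Fin n) :
    ‖feature X A y i‖ ^ 2 ≤ d * M ^ 2 + 4 := by
  rw [norm_sq_param]
  refine add_le_add ?_ ?_
  · calc ∑ k, (feature X A y i).fst k ^ 2 ≤ ∑ _k : Fin d, M ^ 2 :=
          Finset.sum_le_sum fun k _ =>
            sq_le_sq' (abs_le.1 (h.feature_le i k)).1 (abs_le.1 (h.feature_le i k)).2
      _ = d * M ^ 2 := by simp
  · rw [feature_snd, mul_pow, ← sq_abs ((A *ᵥ spin y) i)]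
    nlinarith [h.abs_magnetization_le y i, abs_nonneg ((A *ᵥ spin y) i)]

/-- The gradient is cocoercive, with the constant `d M² + 4` that also determines the step size. -/
lemma Admissible.norm_sq_grad_sub_grad_le (h : Admissible M c q₁ q₂ X A) (hn : 0 < n)
    (y : Config n) (p q : Param d) :
    ‖grad X A y p - grad X A y q‖ ^ 2
      ≤ (d * M ^ 2 + 4) * inner ℝ (grad X A y p - grad X A y q) (p - q) := by
  have hn' : (0 : ℝ) < n := by exact_mod_cast hn
  rw [inner_grad_sub_grad h.symm h.diag_zero]
  set τ : Fin n → ℝ := fun i => Real.tanh (field X A y p i) - Real.tanh (field X A y q i)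
  have e : grad X A y p - grad X A y q = (1 / (n : ℝ)) • ∑ i, τ i • feature X A y i := by
    rw [grad_eq h.symm h.diag_zero, grad_eq h.symm h.diag_zero, ← smul_sub,
      ← Finset.sum_sub_distrib]
    congr 1
    refine Finset.sum_congr rfl fun i _ => ?_
    rw [← sub_smul]; congr 1; simp only [τ]; ring
  have h1 : ‖∑ i, τ i • feature X A y i‖ ≤ ∑ i, |τ i| * ‖feature X A y i‖ :=
    (norm_sum_le _ _).trans_eq (Finset.sum_congr rfl fun i _ => by rw [norm_smul, Real.norm_eq_abs])
  have h2 : (∑ i, |τ i| * ‖feature X A y i‖) ^ 2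
      ≤ (∑ i, |τ i| ^ 2) * ∑ i, ‖feature X A y i‖ ^ 2 := Finset.sum_mul_sq_le_sq_mul_sq _ _ _
  have h3 : ∑ i, ‖feature X A y i‖ ^ 2 ≤ n * (d * M ^ 2 + 4) :=
    (Finset.sum_le_sum fun i _ => h.norm_feature_sq_le y i).trans_eq (by simp; ring)
  have h4 : ∑ i, |τ i| ^ 2 ≤ ∑ i, τ i * (field X A y p i - field X A y q i) :=
    Finset.sum_le_sum fun i _ => by rw [sq_abs]; exact sq_tanh_sub_le _ _
  have h5 : 0 ≤ ∑ i, |τ i| ^ 2 := Finset.sum_nonneg fun i _ => sq_nonneg _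
  rw [e, norm_smul, mul_pow, Real.norm_eq_abs, sq_abs]
  calc (1 / (n : ℝ)) ^ 2 * ‖∑ i, τ i • feature X A y i‖ ^ 2
      ≤ (1 / (n : ℝ)) ^ 2 * ((∑ i, |τ i| ^ 2) * (n * (d * M ^ 2 + 4))) := by
        refine mul_le_mul_of_nonneg_left ?_ (by positivity)
        exact (pow_le_pow_left₀ (norm_nonneg _) h1 2).trans
          (h2.trans (mul_le_mul_of_nonneg_left h3 h5))
    _ = (d * M ^ 2 + 4) * ((1 / (n : ℝ)) * ∑ i, |τ i| ^ 2) := by field_simp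
    _ ≤ _ := by gcongr

/-! ### Existence and uniqueness of the estimate -/

lemma abs_fst_le_norm (v : Param d) (k : Fin d) : |v.fst k| ≤ ‖v‖ := by
  refine abs_le_of_sq_le_sq ?_ (norm_nonneg _)
  rw [norm_sq_param]
  have := Finset.single_le_sum (f := fun k => v.fst k ^ 2) (fun k _ => sq_nonneg _)
    (Finset.mem_univ k)
  have h2 := sq_nonneg v.snd
  linarith

lemma abs_snd_le_norm (v : Param d) : |v.snd| ≤ ‖v‖ := by
  refine abs_le_of_sq_le_sq ?_ (norm_nonneg _)
  rw [norm_sq_param]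
  have : 0 ≤ ∑ k, v.fst k ^ 2 := Finset.sum_nonneg fun k _ => sq_nonneg _
  linarith

lemma InBox.of_norm_sub_le {T b r : ℝ} {p q : Param d} (hp : InBox T b p) (h : ‖q - p‖ ≤ r) :
    InBox (T + r) (b + r) q := by
  constructor
  · intro k
    have h1 : |q.fst k - p.fst k| ≤ ‖q - p‖ := by
      simpa using abs_fst_le_norm (q - p) k
    have h2 := abs_sub_abs_le_abs_sub (q.fst k) (p.fst k)
    linarith [hp.1 k]
  · have h1 : |q.snd - p.snd| ≤ ‖q - p‖ := by
      simpa using abs_snd_le_norm (q - p)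
    have h2 := abs_sub_abs_le_abs_sub q.snd p.snd
    linarith [hp.2]

lemma continuous_neg_LPL (hA : A.IsSymm) (h0 : ∀ i, A i i = 0) (y : Config n) :
    Continuous fun p : Param d => -LPL X A y p := by
  simp only [neg_LPL_eq hA h0]
  have hf : ∀ i, Continuous fun p : Param d => field X A y p i := fun i =>
    (innerSL ℝ (feature X A y i)).continuous
  refine continuous_const.mul (continuous_finsetSum _ fun i _ => Continuous.sub
    (Continuous.log (continuous_const.mul (Real.continuous_cosh.comp (hf i))) fun p => ?_)
    (continuous_const.mul (hf i)))
  have := Real.cosh_pos (field X A y p i)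
  exact (mul_pos two_pos this).ne'

lemma grad_eq_zero_of_isLocalMin {y : Config n} {p : Param d}
    (h : IsLocalMin (fun q => -LPL X A y q) p) : grad X A y p = 0 := by
  rw [grad, gradient, h.fderiv_eq_zero, map_zero]

lemma isMPLE_iff_grad_eq_zero (hA : A.IsSymm) (h0 : ∀ i, A i i = 0) (hn : 0 < n) {y : Config n}
    {p : Param d} : IsMPLE X A y p ↔ grad X A y p = 0 := by
  rw [isMPLE_iff hn]
  refine ⟨fun h => grad_eq_zero_of_isLocalMin (Filter.Eventually.of_forall h), fun h q => ?_⟩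
  have := neg_LPL_convex (X := X) hA h0 y p q
  rwa [h, inner_zero_left, add_zero] at this

lemma eq_of_grad_eq_zero (hA : A.IsSymm) (h0 : ∀ i, A i i = 0) (hn : 0 < n) {y : Config n}
    {κ : ℝ} (hκ0 : 0 < κ) (hκ : ∀ v : Param d, κ * n * ‖v‖ ^ 2 ≤ ∑ i, field X A y v i ^ 2)
    {p q : Param d} (hp : grad X A y p = 0) (hq : grad X A y q = 0) : q = p := by
  have hn' : (0 : ℝ) < n := by exact_mod_cast hn
  set R := ∑ i, |field X A y q i| + ∑ i, |field X A y p i|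
  have hle : ∀ (f : Fin n → ℝ) i, |f i| ≤ ∑ i, |f i| := fun f i =>
    Finset.single_le_sum (f := fun i => |f i|) (fun i _ => abs_nonneg _) (Finset.mem_univ i)
  have hnn : ∀ f : Fin n → ℝ, 0 ≤ ∑ i, |f i| := fun f => Finset.sum_nonneg fun i _ => abs_nonneg _
  have h := strongMono_grad (X := X) (R := R) hA h0 hn (y := y) (p := q) (q := p)
    (fun i => (hle (field X A y q) i).trans (le_add_of_nonneg_right (hnn _)))
    (fun i => (hle (field X A y p) i).trans (le_add_of_nonneg_left (hnn _))) hκ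
  rw [hp, hq, sub_zero, inner_zero_left] at h
  have hpos : 0 < (1 - Real.tanh R ^ 2) * κ := mul_pos (one_sub_tanh_sq_pos R) hκ0
  have h2 : ‖q - p‖ ^ 2 ≤ 0 := le_of_mul_le_mul_left (by simpa using h) hpos
  have h3 : ‖q - p‖ = 0 := by
    have := sq_nonneg ‖q - p‖
    exact pow_eq_zero_iff (two_ne_zero) |>.1 (le_antisymm h2 this)
  exact sub_eq_zero.1 (norm_eq_zero.1 h3)

/-- If the gradient at `p₀` is small compared with the strong convexity near `p₀`, then there is a
critical point near `p₀`. -/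
lemma exists_grad_eq_zero (hA : A.IsSymm) (h0 : ∀ i, A i i = 0) (hn : 0 < n) {y : Config n}
    {κ R ρ : ℝ} (hκ : ∀ v : Param d, κ * n * ‖v‖ ^ 2 ≤ ∑ i, field X A y v i ^ 2)
    {p₀ : Param d} (hρ : 0 < ρ)
    (hR : ∀ p : Param d, ‖p - p₀‖ ≤ ρ → ∀ i, |field X A y p i| ≤ R)
    (hg : ‖grad X A y p₀‖ < (1 - Real.tanh R ^ 2) * κ / 2 * ρ) :
    ∃ p : Param d, ‖p - p₀‖ ≤ ρ ∧ grad X A y p = 0 := by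
  have hn' : (0 : ℝ) < n := by exact_mod_cast hn
  obtain ⟨p, hp, hmin⟩ := (isCompact_closedBall p₀ ρ).exists_isMinOn
    ⟨p₀, Metric.mem_closedBall_self hρ.le⟩
    (continuous_neg_LPL (X := X) hA h0 y).continuousOn
  rw [Metric.mem_closedBall, dist_eq_norm] at hp
  refine ⟨p, hp, grad_eq_zero_of_isLocalMin ?_⟩
  have hlt : ‖p - p₀‖ < ρ := by
    refine lt_of_le_of_ne hp fun heq => ?_
    -- strong convexity makes the objective larger on the sphere than at the centre
    have h1 := neg_LPL_ge (X := X) hA h0 (hR p₀ (by simpa using hρ.le)) (hR p hp)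
    have h2 : -LPL X A y p ≤ -LPL X A y p₀ := hmin (Metric.mem_closedBall_self hρ.le)
    have h3 : -(‖grad X A y p₀‖ * ρ) ≤ inner ℝ (grad X A y p₀) (p - p₀) := by
      rw [← heq]; exact (abs_le.1 (abs_real_inner_le_norm _ _)).1
    have h4 : κ * ρ ^ 2 ≤ (1 / (n : ℝ)) * ∑ i, field X A y (p - p₀) i ^ 2 := by
      have := hκ (p - p₀)
      rw [heq] at this
      rw [one_div, ← div_eq_inv_mul, le_div_iff₀ hn']
      linarith
    have h5 := mul_le_mul_of_nonneg_left h4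
      (show 0 ≤ (1 - Real.tanh R ^ 2) / 2 by linarith [one_sub_tanh_sq_pos R])
    have h6 := mul_lt_mul_of_pos_right hg hρ
    nlinarith
  have hball : Metric.closedBall p₀ ρ ∈ nhds p :=
    Filter.mem_of_superset (Metric.isOpen_ball.mem_nhds (by rwa [Metric.mem_ball, dist_eq_norm]))
      Metric.ball_subset_closedBall
  exact hmin.isLocalMin hball

/-! ### Convergence of projected gradient descent -/

lemma abs_clamp_sub_clamp_le (T a b : ℝ) :
    |max (-T) (min T a) - max (-T) (min T b)| ≤ |a - b| := by
  refine (abs_max_sub_max_le_max _ _ _ _).trans ?_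
  rw [sub_self, abs_zero]
  refine max_le (abs_nonneg _) ((abs_min_sub_min_le_max _ _ _ _).trans ?_)
  rw [sub_self, abs_zero]
  exact max_le (abs_nonneg _) le_rfl

lemma norm_projBox_sub_projBox_le (Θ B : ℝ) (p q : Param d) :
    ‖projBox Θ B p - projBox Θ B q‖ ≤ ‖p - q‖ := by
  refine abs_le_of_sq_le_sq' ?_ (norm_nonneg _) |>.2
  rw [norm_sq_param, norm_sq_param]
  refine add_le_add (Finset.sum_le_sum fun k _ => ?_) ?_
  · exact sq_le_sq.2 (by simpa [projBox] using abs_clamp_sub_clamp_le Θ (p.fst k) (q.fst k))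
  · exact sq_le_sq.2 (by simpa [projBox] using abs_clamp_sub_clamp_le B p.snd q.snd)

lemma clamp_eq_self {T a : ℝ} (h : |a| ≤ T) : max (-T) (min T a) = a := by
  rw [min_eq_right (abs_le.1 h).2, max_eq_right (abs_le.1 h).1]

lemma projBox_eq_self {Θ B : ℝ} {p : Param d} (h : InBox Θ B p) : projBox Θ B p = p := by
  apply (WithLp.equiv 2 _).injective
  refine Prod.ext ?_ (clamp_eq_self h.2)
  ext k
  exact clamp_eq_self (h.1 k)

lemma abs_clamp_le {T : ℝ} (hT : 0 ≤ T) (a : ℝ) : |max (-T) (min T a)| ≤ T :=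
  abs_le.2 ⟨le_max_left _ _, max_le (by linarith) (min_le_left _ _)⟩

lemma inBox_projBox {Θ B : ℝ} (hΘ : 0 ≤ Θ) (hB : 0 ≤ B) (p : Param d) :
    InBox Θ B (projBox Θ B p) :=
  ⟨fun k => abs_clamp_le hΘ (p.fst k), abs_clamp_le hB p.snd⟩

lemma inBox_pgdIter {Θ B η : ℝ} (hΘ : 0 ≤ Θ) (hB : 0 ≤ B) (y : Config n) (t : ℕ) :
    InBox Θ B (pgdIter X A y Θ B η t) := by
  cases t with
  | zero => exact ⟨fun k => by simpa [pgdIter] using hΘ, by simpa [pgdIter] using hB⟩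
  | succ t => exact inBox_projBox hΘ hB _

/-- One step of projected gradient descent contracts the squared distance to a critical point in
the box: the projection does not increase distances, and cocoercivity absorbs the quadratic term
in the step size. -/
lemma Admissible.norm_sq_pgdStep_sub_le (h : Admissible M c q₁ q₂ X A) (hn : 0 < n) {Θ B R κ : ℝ}
    {y : Config n} (hκ : ∀ v : Param d, κ * n * ‖v‖ ^ 2 ≤ ∑ i, field X A y v i ^ 2)
    (hR : ∀ p : Param d, InBox Θ B p → ∀ i, |field X A y p i| ≤ R)
    {p q : Param d} (hp : InBox Θ B p) (hq : InBox Θ B q) (hgrad : grad X A y q = 0) :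
    ‖pgdStep X A y Θ B (1 / (d * M ^ 2 + 4)) p - q‖ ^ 2
      ≤ (1 - 1 / (d * M ^ 2 + 4) * ((1 - Real.tanh R ^ 2) * κ)) * ‖p - q‖ ^ 2 := by
  have hℓ : (0 : ℝ) < d * M ^ 2 + 4 := by positivity
  set η : ℝ := 1 / (d * M ^ 2 + 4) with hη
  have hη0 : 0 < η := by positivity
  have h1 := strongMono_grad h.symm h.diag_zero hn (hR p hp) (hR q hq) hκ
  have h2 := h.norm_sq_grad_sub_grad_le hn y p q
  rw [hgrad, sub_zero] at h1 h2
  set G := grad X A y p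
  have h3 : ‖pgdStep X A y Θ B η p - q‖ ≤ ‖(p - q) - η • G‖ := by
    have := norm_projBox_sub_projBox_le Θ B (p - η • G) q
    rw [projBox_eq_self hq] at this
    rwa [sub_right_comm] at this
  have h4 : ‖(p - q) - η • G‖ ^ 2
      = ‖p - q‖ ^ 2 - 2 * η * inner ℝ G (p - q) + η ^ 2 * ‖G‖ ^ 2 := by
    rw [norm_sub_sq_real, real_inner_smul_right, real_inner_comm, norm_smul, mul_pow,
      Real.norm_eq_abs, sq_abs]
    ring
  have h5 : η ^ 2 * ‖G‖ ^ 2 ≤ η * inner ℝ G (p - q) := by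
    have e : η ^ 2 * ((d * M ^ 2 + 4) * inner ℝ G (p - q)) = η * inner ℝ G (p - q) := by
      rw [hη]; field_simp
    rw [← e]
    exact mul_le_mul_of_nonneg_left h2 (by positivity)
  have h6 := mul_le_mul_of_nonneg_left h1 hη0.le
  have h7 := pow_le_pow_left₀ (norm_nonneg _) h3 2
  linarith

lemma Admissible.norm_grad_le (h : Admissible M c q₁ q₂ X A) (hn : 0 < n) {y : Config n}
    {p q : Param d} (hgrad : grad X A y q = 0) :
    ‖grad X A y p‖ ≤ (d * M ^ 2 + 4) * ‖p - q‖ := by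
  have h2 := h.norm_sq_grad_sub_grad_le hn y p q
  rw [hgrad, sub_zero] at h2
  have h3 := real_inner_le_norm (grad X A y p) (p - q)
  have hℓ : (0 : ℝ) < d * M ^ 2 + 4 := by positivity
  rcases (norm_nonneg (grad X A y p)).eq_or_lt with h0 | h0
  · rw [← h0]; positivity
  · refine le_of_mul_le_mul_left ?_ h0
    nlinarith

lemma InBox.norm_sq_le {Θ B : ℝ} {p : Param d} (h : InBox Θ B p) :
    ‖p‖ ^ 2 ≤ d * Θ ^ 2 + B ^ 2 := by
  rw [norm_sq_param]
  refine add_le_add ?_ (sq_le_sq' (abs_le.1 h.2).1 (abs_le.1 h.2).2)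
  calc ∑ k, p.fst k ^ 2 ≤ ∑ _k : Fin d, Θ ^ 2 :=
        Finset.sum_le_sum fun k _ => sq_le_sq' (abs_le.1 (h.1 k)).1 (abs_le.1 (h.1 k)).2
    _ = d * Θ ^ 2 := by simp

/-- Projected gradient descent halts after `O(ln n)` iterations, near the critical point. -/
theorem Admissible.pgdReturns (h : Admissible M c q₁ q₂ X A) (hn : 3 ≤ n) {Θ B R κ : ℝ}
    (hΘ : 0 ≤ Θ) (hB : 0 ≤ B) {y : Config n} (hκ0 : 0 < κ)
    (hκ : ∀ v : Param d, κ * n * ‖v‖ ^ 2 ≤ ∑ i, field X A y v i ^ 2)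
    (hR : ∀ p : Param d, InBox Θ B p → ∀ i, |field X A y p i| ≤ R)
    {q : Param d} (hq : InBox Θ B q) (hgrad : grad X A y q = 0) :
    ∃ (T : ℕ) (p : Param d), PGDReturns X A y Θ B (1 / (d * M ^ 2 + 4)) T p ∧
      (T : ℝ) ≤ ((1 + Real.log ((d * M ^ 2 + 4) ^ 2 * (d * Θ ^ 2 + B ^ 2) + 1))
        / (1 / (d * M ^ 2 + 4) * ((1 - Real.tanh R ^ 2) * κ)) + 2) * Real.log n ∧
      ‖q - p‖ ≤ 1 / ((1 - Real.tanh R ^ 2) * κ) / √(n : ℝ) := by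
  have hn0 : 0 < n := by omega
  have hn' : (0 : ℝ) < n := by exact_mod_cast hn0
  set ℓ : ℝ := d * M ^ 2 + 4
  have hℓ : 0 < ℓ := by positivity
  set μ := (1 - Real.tanh R ^ 2) * κ
  have hμ : 0 < μ := mul_pos (one_sub_tanh_sq_pos R) hκ0
  set D := d * Θ ^ 2 + B ^ 2
  have hD : 0 ≤ D := by positivity
  set ν := 1 / ℓ * μ
  have hν : 0 < ν := by positivity
  set x : ℕ → Param d := pgdIter X A y Θ B (1 / ℓ)
  have hx : ∀ t, InBox Θ B (x t) := inBox_pgdIter hΘ hB y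
  have hstep : ∀ t, ‖x (t + 1) - q‖ ^ 2 ≤ (1 - ν) * ‖x t - q‖ ^ 2 := fun t =>
    h.norm_sq_pgdStep_sub_le hn0 hκ hR (hx t) hq hgrad
  have hdecay : ∀ t : ℕ, ‖x t - q‖ ^ 2 ≤ Real.exp (-(ν * t)) * D := by
    intro t
    induction t with
    | zero =>
      have h1 : x 0 = 0 := rfl
      rw [h1, zero_sub, norm_neg]
      simpa using hq.norm_sq_le
    | succ t ih =>
      have h1 : 1 - ν ≤ Real.exp (-ν) := by linarith [Real.add_one_le_exp (-ν)]
      calc ‖x (t + 1) - q‖ ^ 2 ≤ (1 - ν) * ‖x t - q‖ ^ 2 := hstep t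
        _ ≤ Real.exp (-ν) * (Real.exp (-(ν * t)) * D) := by gcongr
        _ = Real.exp (-(ν * (t + 1 : ℕ))) * D := by
          rw [← mul_assoc, ← Real.exp_add]; congr 2; push_cast; ring
  set Λ := Real.log (ℓ ^ 2 * D + 1)
  have hΛ : 0 ≤ Λ := Real.log_nonneg (by linarith [mul_nonneg (sq_nonneg ℓ) hD])
  have hlog : 1 ≤ Real.log n := by
    rw [Real.le_log_iff_exp_le hn']
    have : (3 : ℝ) ≤ n := by exact_mod_cast hn
    linarith [Real.exp_one_lt_d9]
  have hhalt : ∃ t, ‖grad X A y (x t)‖ ≤ 1 / √(n : ℝ) ∧ (t : ℝ) ≤ (Real.log n + Λ) / ν + 1 := by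
    refine ⟨⌈(Real.log n + Λ) / ν⌉₊, ?_, (Nat.ceil_lt_add_one (by positivity)).le⟩
    set t := ⌈(Real.log n + Λ) / ν⌉₊
    have ht : Real.log n + Λ ≤ ν * t := by
      have := Nat.le_ceil ((Real.log n + Λ) / ν)
      rw [div_le_iff₀ hν] at this
      linarith
    have h1 := h.norm_grad_le hn0 (p := x t) hgrad
    have h2 : Real.exp (-(ν * t)) ≤ 1 / (n * (ℓ ^ 2 * D + 1)) := by
      calc Real.exp (-(ν * t)) ≤ Real.exp (-(Real.log n + Λ)) := by gcongr
        _ = 1 / (n * (ℓ ^ 2 * D + 1)) := by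
          rw [Real.exp_neg, Real.exp_add, Real.exp_log hn', Real.exp_log (by positivity), one_div]
    have h3 : (ℓ * ‖x t - q‖) ^ 2 ≤ 1 / n := by
      calc (ℓ * ‖x t - q‖) ^ 2 = ℓ ^ 2 * ‖x t - q‖ ^ 2 := by ring
        _ ≤ ℓ ^ 2 * (1 / (n * (ℓ ^ 2 * D + 1)) * D) := by
          gcongr
          exact (hdecay t).trans (mul_le_mul_of_nonneg_right h2 hD)
        _ = 1 / n * (ℓ ^ 2 * D / (ℓ ^ 2 * D + 1)) := by field_simp
        _ ≤ 1 / n * 1 := by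
          gcongr
          rw [div_le_one (by positivity)]
          linarith
        _ = 1 / n := mul_one _
    refine h1.trans ?_
    rw [← Real.sqrt_one, ← Real.sqrt_div zero_le_one]
    exact Real.le_sqrt_of_sq_le h3
  classical
  obtain ⟨t₁, ht₁, hbound⟩ := hhalt
  have hex : ∃ t, ‖grad X A y (x t)‖ ≤ 1 / √(n : ℝ) := ⟨t₁, ht₁⟩
  set t := Nat.find hex
  have ht : ‖grad X A y (x t)‖ ≤ 1 / √(n : ℝ) := Nat.find_spec hex
  have htt : (t : ℝ) ≤ t₁ := by exact_mod_cast Nat.find_min' hex ht₁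
  refine ⟨t + 1, x (t + 1), ⟨t, rfl, fun s hs => not_le.1 (Nat.find_min hex hs), ht, rfl⟩, ?_, ?_⟩
  · have h1 : Λ ≤ Λ * Real.log n := le_mul_of_one_le_right hΛ hlog
    have h2 : (Real.log n + Λ) / ν ≤ (1 + Λ) / ν * Real.log n := by
      rw [div_mul_eq_mul_div]
      gcongr
      linarith
    push_cast
    linarith
  · have h1 := strongMono_grad h.symm h.diag_zero hn0 (hR _ (hx t)) (hR q hq) hκ
    rw [hgrad, sub_zero] at h1
    have h2 := real_inner_le_norm (grad X A y (x t)) (x t - q)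
    have h3 : ‖x t - q‖ ≤ 1 / μ / √(n : ℝ) := by
      rcases (norm_nonneg (x t - q)).eq_or_lt with h0 | h0
      · rw [← h0]; positivity
      · have h4 : μ * ‖x t - q‖ ≤ 1 / √(n : ℝ) := by
          refine le_of_mul_le_mul_left ?_ h0
          have := mul_le_mul_of_nonneg_right ht h0.le
          calc ‖x t - q‖ * (μ * ‖x t - q‖) = μ * ‖x t - q‖ ^ 2 := by ring
            _ ≤ _ := h1
            _ ≤ _ := h2
            _ ≤ _ := this
            _ = _ := mul_comm _ _
        rw [div_right_comm, le_div_iff₀ hμ]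
        linarith
    have h4 : ‖x (t + 1) - q‖ ≤ ‖x t - q‖ := by
      refine abs_le_of_sq_le_sq' ?_ (norm_nonneg _) |>.2
      have := hstep t
      nlinarith [sq_nonneg ‖x t - q‖]
    rw [norm_sub_rev]
    exact h4.trans h3

end Model

/-! ### Consistency and the running time of the algorithm -/

/-- On the good event the estimate exists, is unique and is close to the true parameter. -/
lemma Admissible.exists_unique_mple {n d : ℕ} {X : Matrix (Fin n) (Fin d) ℝ}
    {A : Matrix (Fin n) (Fin n) ℝ} {Θ B M c q₁ q₂ g κ μ : ℝ} (h : Admissible M c q₁ q₂ X A)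
    (hn : 0 < n) (hg : 0 < g) (hκ0 : 0 < κ) (hμ0 : 0 < μ)
    (hμ : μ = (1 - Real.tanh (d * ((Θ + 1) * M) + 2 * (B + 1)) ^ 2) * κ)
    (hlarge : (4 * g / μ) ^ 2 ≤ n) {y : Config n} {p₀ : Param d} (hp₀ : InBox Θ B p₀)
    (hgrad : ‖grad X A y p₀‖ ≤ g / √(n : ℝ))
    (hκ : ∀ v : Param d, κ * n * ‖v‖ ^ 2 ≤ ∑ i, field X A y v i ^ 2) :
    ∃ p : Param d, (∀ q, IsMPLE X A y q ↔ q = p) ∧ ‖p - p₀‖ ≤ 4 * g / μ / √(n : ℝ) ∧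
      grad X A y p = 0 := by
  have hn' : (0 : ℝ) < n := by exact_mod_cast hn
  have hs : 0 < √(n : ℝ) := Real.sqrt_pos.2 hn'
  have hρ : 4 * g / μ / √(n : ℝ) ≤ 1 := by
    rw [div_le_one hs]
    exact Real.le_sqrt_of_sq_le hlarge
  obtain ⟨p, hp, hp0⟩ := exists_grad_eq_zero h.symm h.diag_zero hn hκ (p₀ := p₀)
    (ρ := 4 * g / μ / √(n : ℝ)) (by positivity)
    (fun p hp => h.abs_field_le (hp₀.of_norm_sub_le (hp.trans hρ)) y) (by
      rw [← hμ]
      refine hgrad.trans_lt ?_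
      have e : μ / 2 * (4 * g / μ / √(n : ℝ)) = 2 * (g / √(n : ℝ)) := by field_simp; ring
      rw [e]
      have : 0 < g / √(n : ℝ) := by positivity
      linarith)
  refine ⟨p, fun q => ?_, hp, hp0⟩
  rw [isMPLE_iff_grad_eq_zero h.symm h.diag_zero hn]
  exact ⟨fun hq => eq_of_grad_eq_zero h.symm h.diag_zero hn hκ0 hκ hp0 hq, fun hq => hq ▸ hp0⟩

lemma InOpenBox.exists_margin {d : ℕ} (hd : 0 < d) {Θ B : ℝ} {p : Param d}
    (hp : InOpenBox Θ B p) : ∃ r : ℝ, 0 < r ∧ InBox (Θ - r) (B - r) p := by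
  have : Nonempty (Fin d) := ⟨⟨0, hd⟩⟩
  obtain ⟨k₀, hk₀⟩ := Finite.exists_max fun k => |p.fst k|
  refine ⟨min (Θ - |p.fst k₀|) (B - |p.snd|),
    lt_min (sub_pos.2 (abs_lt.2 (hp.1 k₀))) (sub_pos.2 (abs_lt.2 hp.2)), fun k => ?_, ?_⟩
  · linarith [hk₀ k, min_le_left (Θ - |p.fst k₀|) (B - |p.snd|)]
  · linarith [min_le_right (Θ - |p.fst k₀|) (B - |p.snd|)]

end IsingRegression

end

theorem theorem1 :
    -- each iteration takes `O(d n)` time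
    (∃ (P : RealRAM.Cmd) (K : ℕ), IsingRegression.PerformsIteration P K) ∧
    ∀ (d : ℕ), 0 < d →
    ∀ (Θ B M c q₁ q₂ δ : ℝ), 0 < Θ → 0 < B → 0 < M → 0 < c → 0 < q₁ → 0 < q₂ → 0 < δ →
    ∃ C : ℝ, 0 < C ∧
      -- the maximum pseudo-likelihood estimate exists, is unique and is close to the truth
      (∃ n₀ : ℕ, ∀ n : ℕ, n₀ ≤ n →
        ∀ (X : Matrix (Fin n) (Fin d) ℝ) (A : Matrix (Fin n) (Fin n) ℝ),
          IsingRegression.Admissible M c q₁ q₂ X A →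
        ∀ p₀ : IsingRegression.Param d, IsingRegression.InOpenBox Θ B p₀ →
          1 - δ ≤ IsingRegression.prob X A p₀
            {y | ∃ p : IsingRegression.Param d,
              (∀ q, IsingRegression.IsMPLE X A y q ↔ q = p) ∧
              ‖p - p₀‖ ≤ C / √(n : ℝ)}) ∧
      -- projected gradient descent halts after `O(ln n)` iterations, close to the estimate
      (∀ p₀ : IsingRegression.Param d, IsingRegression.InOpenBox Θ B p₀ →
        ∃ n₀ : ℕ, ∀ n : ℕ, n₀ ≤ n →
        ∀ (X : Matrix (Fin n) (Fin d) ℝ) (A : Matrix (Fin n) (Fin n) ℝ),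
          IsingRegression.Admissible M c q₁ q₂ X A →
          1 - δ ≤ IsingRegression.prob X A p₀
            {y | ∃ (p p' : IsingRegression.Param d) (T : ℕ),
              (∀ q, IsingRegression.IsMPLE X A y q ↔ q = p) ∧
              IsingRegression.PGDReturns X A y Θ B (1 / (d * M ^ 2 + 4)) T p' ∧
              (T : ℝ) ≤ C * Real.log n ∧
              ‖p - p'‖ ≤ C / √(n : ℝ)}) := by
  refine ⟨⟨RealRAM.iterationCmd, 400, IsingRegression.performsIteration_iterationCmd⟩, ?_⟩
  intro d hd Θ B M c q₁ q₂ δ hΘ hB hM hc hq₁ _ hδ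
  obtain ⟨g, κ, hg, hκ0, n₁, hgood⟩ :=
    IsingRegression.exists_good_event d (Θ := Θ) (q₂ := q₂) hB hM hc hq₁ hδ
  set R := d * ((Θ + 1) * M) + 2 * (B + 1) with hR
  set μ := (1 - Real.tanh R ^ 2) * κ with hμ
  have hμ0 : 0 < μ := mul_pos (IsingRegression.one_sub_tanh_sq_pos R) hκ0
  -- `C₁` bounds the distance of the estimate to the truth, `C₂` the number of iterations
  set C₁ := 4 * g / μ
  set C₂ := (1 + Real.log ((d * M ^ 2 + 4) ^ 2 * (d * Θ ^ 2 + B ^ 2) + 1))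
    / (1 / (d * M ^ 2 + 4) * μ) + 2
  have hC₁ : 0 < C₁ := by positivity
  have hC₂ : 0 < C₂ := by
    have : 0 ≤ Real.log ((d * M ^ 2 + 4) ^ 2 * (d * Θ ^ 2 + B ^ 2) + 1) :=
      Real.log_nonneg (le_add_of_nonneg_left (by positivity))
    positivity
  have hμ1 : 0 < 1 / μ := by positivity
  refine ⟨C₁ + C₂ + 1 / μ, by positivity, ⟨max 1 (max n₁ ⌈C₁ ^ 2⌉₊), ?_⟩, ?_⟩
  · intro n hn X A h p₀ hp₀
    refine hgood n ((le_max_left _ _).trans ((le_max_right _ _).trans hn)) X A h p₀ hp₀ _ ?_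
    intro y hgrad hκ
    have hlarge : C₁ ^ 2 ≤ n := (Nat.le_ceil _).trans
      (by exact_mod_cast ((le_max_right _ _).trans (le_max_right _ _)).trans hn)
    obtain ⟨p, hp, hdist, -⟩ := h.exists_unique_mple
      (lt_of_lt_of_le one_pos ((le_max_left _ _).trans hn)) hg hκ0 hμ0 hμ hlarge hp₀.inBox hgrad hκ
    exact ⟨p, hp, hdist.trans (by gcongr; linarith)⟩
  · intro p₀ hp₀
    obtain ⟨r, hr, hmargin⟩ := hp₀.exists_margin hd
    refine ⟨max 3 (max n₁ (max ⌈C₁ ^ 2⌉₊ ⌈(C₁ / r) ^ 2⌉₊)), ?_⟩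
    intro n hn X A h
    have hn₁ := (le_max_right _ _).trans hn
    have hn₂ := (le_max_right _ _).trans hn₁
    have hn3 : 3 ≤ n := (le_max_left _ _).trans hn
    have hn0 : 0 < n := by omega
    have hs : 0 < √(n : ℝ) := Real.sqrt_pos.2 (by exact_mod_cast hn0)
    refine hgood n ((le_max_left _ _).trans hn₁) X A h p₀ hp₀ _ ?_
    intro y hgrad hκ
    have hlarge : C₁ ^ 2 ≤ n := (Nat.le_ceil _).trans
      (by exact_mod_cast (le_max_left _ _).trans hn₂)
    have hinside : (C₁ / r) ^ 2 ≤ n := (Nat.le_ceil _).trans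
      (by exact_mod_cast (le_max_right _ _).trans hn₂)
    obtain ⟨p, hp, hdist, hp0⟩ :=
      h.exists_unique_mple hn0 hg hκ0 hμ0 hμ hlarge hp₀.inBox hgrad hκ
    -- for large `n` the estimate lies in the box, because `p₀` is an interior point
    have hpr : ‖p - p₀‖ ≤ r := by
      refine hdist.trans ?_
      rw [div_le_iff₀ hs, mul_comm r, ← div_le_iff₀ hr]
      exact Real.le_sqrt_of_sq_le hinside
    have hbox : IsingRegression.InBox Θ B p := by
      simpa using hmargin.of_norm_sub_le hpr
    have hfield : ∀ q : IsingRegression.Param d, IsingRegression.InBox Θ B q →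
        ∀ i, |IsingRegression.field X A y q i| ≤ R := fun q hq i =>
      (h.abs_field_le hq y i).trans (by rw [hR]; gcongr <;> linarith)
    obtain ⟨T, p', hret, hT, hclose⟩ :=
      h.pgdReturns hn3 hΘ.le hB.le hκ0 hκ hfield hbox hp0
    refine ⟨p, p', T, hp, hret, hT.trans ?_, hclose.trans ?_⟩
    · refine mul_le_mul_of_nonneg_right ?_ (Real.log_natCast_nonneg n)
      exact le_trans (le_of_eq rfl) (show C₂ ≤ C₁ + C₂ + 1 / μ by linarith)
    · gcongr
      linarith
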